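/- **Setting.** Let $|\psi\rangle$ be an $n$-qubit pure state and, for $x=(a,b)\in\mathbb F_2^{2n}$, let $W_x=i^{a\cdot b}\,X^{a_1}Z^{b_1}\otimes\cdots\otimes X^{a_n}Z^{b_n}$ be the Weyl operators. Put $p(x)=2^{-n}|\langle\psi|W_x|\psi\rangle|^2$ and $q(x)=\sum_y p(y)p(x+y)$ (the law of Bell difference sampling). Let $\gamma>0$ with $\mathbb E_{x\sim q}[2^np(x)]\ge\gamma$ (so $\gamma\le 1$), and let $S\subseteq\mathbb F_2^{2n}$ satisfy $2^np(x)\ge\gamma/4$ for all $x\in S$, $|S|\ge \frac{\gamma^2}{80}2^n$ and $\Pr_{x,y\in S}[x+y\in S]\ge \gamma^5/20$. Let $D$ be the distribution on $S$ with $D(x)=q(x)\,2^np(x)\big/\sum_{y\in S}q(y)\,2^np(y)$, that is, Bell difference sampling, retained with probability $2^np(x)$, conditioned on landing in $S$. For $\zeta>0$ let $$\mathcal E_\zeta=\{(x,y): x+y\in S,\ 2^np(x),\,2^np(y),\,2^np(x+y)\ge\zeta\},\qquad N_\zeta(u)=\{v\in S:(u,v)\in\mathcal E_\zeta\},$$ $$T(u,\zeta_1,\zeta_2,\zeta_3,\rho_1,\rho_2)=\Big\{v\in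 N_{\zeta_1}(u):\Pr_{v_1\sim D}\big[v_1\in N_{\zeta_2}(u)\text{ and }\Pr_{v_2\sim D}[v_2\in N_{\zeta_3}(v)\cap N_{\zeta_3}(v_1)]\le\rho_1\big]\le\rho_2\Big\}.$$ **Parameters.** $C_1=2^{10}\cdot10^2$, $C_2=2^{39}\cdot10^{15}$, $\rho_1=\frac{\gamma^{350}}{10240\,C_1^3C_2^5}$, $\rho_2=\frac{9\gamma^{202}}{2560\,C_1C_2^3}$, $\rho_3=\frac{\gamma^{349}}{2560\,C_1^3C_2^5}$. Divide $[\gamma/180,\gamma/18]$ into $\lceil 1/\rho_3\rceil$ equal consecutive sub-intervals and choose one uniformly at random; write it as $[\zeta-\mu,\zeta+\mu]$, and put $\zeta_1=\zeta_3=\zeta+\mu/2$, $\zeta_2=\zeta-\mu/2$. Let $$A^{(1)}(u)=T(u,\zeta+\mu,\zeta-\mu,\zeta+\mu,\rho_1,\rho_2),\qquad A^{(2)}(u)=T\big(u,\zeta,\zeta,\zeta,\tfrac{10}{11}\rho_1,\tfrac{10}{9}\rho_2\big).$$ **Tests.** EDGE-TEST$(x,y,\zeta)$ makes, for each of the points $g\in\{x,y,x+y\}$,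 $m$ independent measurements of $|\psi\rangle^{\otimes2}$ with respect to $W_g^{\otimes2}$ on fresh copies, and takes the average of the $\pm1$ outcomes as an estimate of $2^np(g)$. If all three estimates are $\ge\zeta$, it returns the retention bit of $x+y$ ($1$ if $x+y\in S$, and $0$ if not); otherwise it returns $0$. BSG-TEST$(u,v,\zeta_1,\zeta_2,\zeta_3,\tau_1,\tau_2)$ draws independent samples $z^{(k)}\sim D$ ($k\le r$) and $w^{(k,\ell)}\sim D$ ($k\le r$, $\ell\le s$), and outputs $0$ if EDGE-TEST$(u,v,\zeta_1)=0$. Otherwise it sets, with fresh measurements for every call, $X_k=$ EDGE-TEST$(u,z^{(k)},\zeta_2)$, $Y_{k\ell}=$ EDGE-TEST$(v,w^{(k,\ell)},\zeta_3)$, $Z_{k\ell}=$ EDGE-TEST$(z^{(k)},w^{(k,\ell)},\zeta_3)$, and $B_k=1$ if $\frac1s\sum_\ell Y_{k\ell}Z_{k\ell}\le\tau_1$, $B_k=0$ otherwise. It outputs $1$ if $\frac1r\sum_kX_kB_k\le\tau_2$, and $0$ otherwise. **Theorem.** There are choices of $r,s,m$ depending only on $\gamma$ and $\delta$ and bounded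 by a fixed polynomial in $1/\gamma$ and $1+\log(1/\delta)$, and absolute constants in $\Omega(\cdot)$ and $O(\cdot)$, such that for all $n,\psi,\gamma,S$ as above the following holds. 1. For every $u\in S$ and every choice of the sub-interval, $A^{(1)}(u)\subseteq A^{(2)}(u)$. Moreover, for every $\delta\in(0,1)$ and $v\in S$, with probability at least $1-\delta$ the output $F$ of BSG-TEST$(u,v,\zeta_1,\zeta_2,\zeta_3,\tfrac{21}{22}\rho_1,\tfrac{19}{18}\rho_2)$ satisfies both $F=1\Rightarrow v\in A^{(2)}(u)$ and $F=0\Rightarrow v\notin A^{(1)}(u)$. 2. With probability at least $\Omega(\gamma^{487})$ over independent $u\sim D$ and the random sub-interval, $$|A^{(1)}(u)|\ge\Omega(\gamma^{138})\,|S|,\qquad |A^{(2)}(u)+A^{(2)}(u)|\le O(\gamma^{-932})\,|S|,\qquad \frac{|A^{(1)}(u)|}{|A^{(2)}(u)|}\ge\Omega(\gamma^{1070}).$$ -/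

import Mathlib

open scoped Matrix Kronecker Pointwise

noncomputable section

namespace BSG

/-! ### Weyl operators and the distributions attached to a state -/

/-- Bit strings of length `n`; they label the computational basis of `n` qubits. -/
abbrev Bits (n : ℕ) : Type := Fin n → ZMod 2

/-- The group `𝔽₂²ⁿ`, written as pairs `(a, b)` of `n`-bit strings. -/
abbrev Vec (n : ℕ) : Type := Bits n × Bits n

/-- The Pauli matrix `X`. -/
def pauliX : Matrix (ZMod 2) (ZMod 2) ℂ := Matrix.of fun s t => if s = t + 1 then 1 else 0

/-- The Pauli matrix `Z`. -/
def pauliZ : Matrix (ZMod 2) (ZMod 2) ℂ := Matrix.diagonal fun s => if s = 0 then 1 else -1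

/-- The Weyl operator `W_(a,b) = i^(a·b) (X^a₁ Z^b₁ ⊗ ⋯ ⊗ X^aₙ Z^bₙ)`, with `a·b` computed in the
integers; the entries of a tensor product are the products of the entries of the factors. -/
def weyl {n : ℕ} (x : Vec n) : Matrix (Bits n) (Bits n) ℂ :=
  Matrix.of fun y z => Complex.I ^ (∑ i, (x.1 i).val * (x.2 i).val) *
    ∏ i, (pauliX ^ (x.1 i).val * pauliZ ^ (x.2 i).val) (y i) (z i)

/-- `ψ` is (the amplitude vector of) a pure state. -/
def IsState {n : ℕ} (ψ : Bits n → ℂ) : Prop := ∑ y, ‖ψ y‖ ^ 2 = 1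

/-- The characteristic distribution `p(x) = |⟨ψ|W_x|ψ⟩|² / 2ⁿ`. -/
def charDist {n : ℕ} (ψ : Bits n → ℂ) (x : Vec n) : ℝ :=
  ‖star ψ ⬝ᵥ (weyl x *ᵥ ψ)‖ ^ 2 / 2 ^ n

/-- The Weyl distribution `q(x) = ∑_y p(y) p(x + y)`: the law of Bell difference sampling. -/
def weylDist {n : ℕ} (ψ : Bits n → ℂ) (x : Vec n) : ℝ :=
  ∑ y, charDist ψ y * charDist ψ (x + y)

/-- `2ⁿ p(x) = |⟨ψ|W_x|ψ⟩|²`. -/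
def weight {n : ℕ} (ψ : Bits n → ℂ) (x : Vec n) : ℝ := 2 ^ n * charDist ψ x

open Classical in
/-- The level set `S_η = {x : 2ⁿ p(x) ≥ η}`. -/
def levelSet {n : ℕ} (ψ : Bits n → ℂ) (η : ℝ) : Finset (Vec n) :=
  Finset.univ.filter fun x => η ≤ weight ψ x

open Classical in
/-- `Pr_{x,y ∈ S}[x + y ∈ S]` for independent uniform `x, y ∈ S`. -/
def additiveDensity {n : ℕ} (S : Finset (Vec n)) : ℝ :=
  (((S ×ˢ S).filter fun xy => xy.1 + xy.2 ∈ S).card : ℝ) / (S.card : ℝ) ^ 2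

/-- `S` is a good approximate subgroup for the state `ψ` and the parameter `γ`. -/
structure IsGoodSet {n : ℕ} (ψ : Bits n → ℂ) (γ : ℝ) (S : Finset (Vec n)) : Prop where
  subset_level : S ⊆ levelSet ψ (γ / 4)
  card_ge : γ ^ 2 / 80 * 2 ^ n ≤ (S.card : ℝ)
  density_ge : γ ^ 5 / 20 ≤ additiveDensity S

open Classical in
/-- The distribution `D` on `S`: Bell difference sampling, retained with probability `2ⁿ p(x)`,
conditioned on landing in `S`. -/
def sampleDist {n : ℕ} (ψ : Bits n → ℂ) (S : Finset (Vec n)) (x : Vec n) : ℝ :=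
  if x ∈ S then weylDist ψ x * weight ψ x / ∑ y ∈ S, weylDist ψ y * weight ψ y else 0

open Classical in
/-- `Pr_{x ∼ D}[E x]`. -/
def prSample {n : ℕ} (ψ : Bits n → ℂ) (S : Finset (Vec n)) (E : Vec n → Prop) : ℝ :=
  ∑ x, if E x then sampleDist ψ S x else 0

/-! ### The graphs and the sets attached to a vertex -/

/-- `(x, y)` lies in the edge set `ℰ_ζ`. -/
def IsEdge {n : ℕ} (ψ : Bits n → ℂ) (S : Finset (Vec n)) (ζ : ℝ) (x y : Vec n) : Prop :=
  x + y ∈ S ∧ ζ ≤ weight ψ x ∧ ζ ≤ weight ψ y ∧ ζ ≤ weight ψ (x + y)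

open Classical in
/-- The neighbourhood `N_ζ(u)`, inside `S`. -/
def nbhd {n : ℕ} (ψ : Bits n → ℂ) (S : Finset (Vec n)) (ζ : ℝ) (u : Vec n) : Finset (Vec n) :=
  S.filter fun v => IsEdge ψ S ζ u v

open Classical in
/-- The set `T(u, ζ₁, ζ₂, ζ₃, ρ₁, ρ₂)`. -/
def setT {n : ℕ} (ψ : Bits n → ℂ) (S : Finset (Vec n)) (u : Vec n) (ζ₁ ζ₂ ζ₃ ρ₁ ρ₂ : ℝ) :
    Finset (Vec n) :=
  (nbhd ψ S ζ₁ u).filter fun v =>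
    prSample ψ S (fun v₁ => v₁ ∈ nbhd ψ S ζ₂ u ∧
      prSample ψ S (fun v₂ => v₂ ∈ nbhd ψ S ζ₃ v ∩ nbhd ψ S ζ₃ v₁) ≤ ρ₁) ≤ ρ₂

/-! ### Parameters -/

def C₁ : ℝ := 2 ^ 10 * 10 ^ 2

def C₂ : ℝ := 2 ^ 39 * 10 ^ 15

def rho₁ (γ : ℝ) : ℝ := γ ^ 350 / (10240 * C₁ ^ 3 * C₂ ^ 5)

def rho₂ (γ : ℝ) : ℝ := 9 * γ ^ 202 / (2560 * C₁ * C₂ ^ 3)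

def rho₃ (γ : ℝ) : ℝ := γ ^ 349 / (2560 * C₁ ^ 3 * C₂ ^ 5)

/-- The number of equal consecutive sub-intervals of `[γ/180, γ/18]`: `1/ρ₃`, rounded up. -/
def numIntervals (γ : ℝ) : ℕ := ⌈1 / rho₃ γ⌉₊

/-- Half the width of a sub-interval; the interval `[γ/180, γ/18]` has length `γ/20`. -/
def mu (γ : ℝ) : ℝ := γ / 20 / numIntervals γ / 2

/-- The centre of the `j`-th sub-interval. -/
def zeta (γ : ℝ) (j : Fin (numIntervals γ)) : ℝ := γ / 180 + (2 * ((j : ℕ) : ℝ) + 1) * mu γ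

/-- `A⁽¹⁾(u)` for the `j`-th sub-interval. -/
def setA₁ {n : ℕ} (ψ : Bits n → ℂ) (S : Finset (Vec n)) (γ : ℝ) (j : Fin (numIntervals γ))
    (u : Vec n) : Finset (Vec n) :=
  setT ψ S u (zeta γ j + mu γ) (zeta γ j - mu γ) (zeta γ j + mu γ) (rho₁ γ) (rho₂ γ)

/-- `A⁽²⁾(u)` for the `j`-th sub-interval. -/
def setA₂ {n : ℕ} (ψ : Bits n → ℂ) (S : Finset (Vec n)) (γ : ℝ) (j : Fin (numIntervals γ))
    (u : Vec n) : Finset (Vec n) :=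
  setT ψ S u (zeta γ j) (zeta γ j) (zeta γ j) (10 * rho₁ γ / 11) (10 * rho₂ γ / 9)

open Classical in
/-- The probability of `E j u` for a uniformly random sub-interval `j` and an independent
`u ∼ D`. -/
def prChoice {n : ℕ} (ψ : Bits n → ℂ) (S : Finset (Vec n)) (γ : ℝ)
    (E : Fin (numIntervals γ) → Vec n → Prop) : ℝ :=
  (∑ j, prSample ψ S (E j)) / numIntervals γ

/-! ### The algorithms

The randomness of a run is recorded as an element of a finite type, with its probability as an
explicit product. -/

/-- The eigenvalue reported by a measurement. -/
def eigenvalue (b : Bool) : ℝ := if b then 1 else -1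

/-- The state `ψ ⊗ ψ`. -/
def twoCopies {n : ℕ} (ψ : Bits n → ℂ) : Bits n × Bits n → ℂ := fun y => ψ y.1 * ψ y.2

/-- The projector on the `±1` eigenspace of `W_x ⊗ W_x`. -/
def eigenprojector {n : ℕ} (x : Vec n) (b : Bool) :
    Matrix (Bits n × Bits n) (Bits n × Bits n) ℂ :=
  (1 / 2 : ℂ) • (1 + (eigenvalue b : ℂ) • (weyl x ⊗ₖ weyl x))

/-- Born's rule: the probability that measuring `ψ ⊗ ψ` with respect to `W_x ⊗ W_x` reports the
eigenvalue of `b`. -/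
def outcomeProb {n : ℕ} (ψ : Bits n → ℂ) (x : Vec n) (b : Bool) : ℝ :=
  (star (twoCopies ψ) ⬝ᵥ (eigenprojector x b *ᵥ twoCopies ψ)).re

/-- The outcomes of the `T` measurements made for each of the three points `x, y, x + y` in one
call of the edge test. -/
abbrev EdgeRun (T : ℕ) : Type := Fin 3 → Fin T → Bool

/-- The probability of the measurement outcomes `m` in a call of the edge test on `(x, y)`. -/
def edgeRunProb {n T : ℕ} (ψ : Bits n → ℂ) (x y : Vec n) (m : EdgeRun T) : ℝ :=
  ∏ i, ∏ t, outcomeProb ψ ((![x, y, x + y] : Fin 3 → Vec n) i) (m i t)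

/-- The estimates of `2ⁿ p(x)`, `2ⁿ p(y)`, `2ⁿ p(x + y)` (for `i = 0, 1, 2`). -/
def estimate {T : ℕ} (m : EdgeRun T) (i : Fin 3) : ℝ := (∑ t, eigenvalue (m i t)) / T

open Classical in
/-- The edge test on `(x, y)` with threshold `ζ`: if all three estimates reach `ζ`, it returns the
retention bit of `x + y` (`1` if `x + y` was retained in the choice set `S`, `0` if not), and it
returns `0` otherwise. -/
def edgeTest {n T : ℕ} (S : Finset (Vec n)) (ζ : ℝ) (x y : Vec n) (m : EdgeRun T) : ℕ :=
  if ∀ i, ζ ≤ estimate m i then (if x + y ∈ S then 1 else 0) else 0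

/-- The randomness used by a run of the BSG test: the samples `z⁽ᵏ⁾` and `w⁽ᵏˡ⁾`, and then the
measurement outcomes in the edge tests on `(u, v)`, on `(u, z⁽ᵏ⁾)`, on `(v, w⁽ᵏˡ⁾)` and on
`(z⁽ᵏ⁾, w⁽ᵏˡ⁾)`. -/
abbrev BSGRun (n r s T : ℕ) : Type :=
  (Fin r → Vec n) × (Fin r → Fin s → Vec n) × EdgeRun T × (Fin r → EdgeRun T) ×
    (Fin r → Fin s → EdgeRun T) × (Fin r → Fin s → EdgeRun T)

/-- The probability of a run of the BSG test on `(u, v)`: the samples are independent with law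
`D`, and all measurements are made on fresh copies. -/
def bsgRunProb {n r s T : ℕ} (ψ : Bits n → ℂ) (S : Finset (Vec n)) (u v : Vec n) :
    BSGRun n r s T → ℝ
  | (z, w, m, mX, mY, mZ) =>
    (∏ k, sampleDist ψ S (z k)) * (∏ k, ∏ l, sampleDist ψ S (w k l)) *
      edgeRunProb ψ u v m * (∏ k, edgeRunProb ψ u (z k) (mX k)) *
      (∏ k, ∏ l, edgeRunProb ψ v (w k l) (mY k l)) *
      (∏ k, ∏ l, edgeRunProb ψ (z k) (w k l) (mZ k l))

open Classical in
/-- The output of the BSG test on `(u, v)` with edge thresholds `ζ₁, ζ₂, ζ₃` and frequency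
thresholds `τ₁, τ₂`. -/
def bsgTest {n r s T : ℕ} (S : Finset (Vec n)) (u v : Vec n) (ζ₁ ζ₂ ζ₃ τ₁ τ₂ : ℝ) :
    BSGRun n r s T → ℕ
  | (z, w, m, mX, mY, mZ) =>
    let X : Fin r → ℕ := fun k => edgeTest S ζ₂ u (z k) (mX k)
    let Y : Fin r → Fin s → ℕ := fun k l => edgeTest S ζ₃ v (w k l) (mY k l)
    let Z : Fin r → Fin s → ℕ := fun k l => edgeTest S ζ₃ (z k) (w k l) (mZ k l)
    let B : Fin r → ℕ := fun k => if (∑ l, (Y k l * Z k l : ℝ)) / s ≤ τ₁ then 1 else 0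
    if edgeTest S ζ₁ u v m = 0 then 0
    else if (∑ k, (X k * B k : ℝ)) / r ≤ τ₂ then 1 else 0

open Classical in
set_option synthInstance.maxHeartbeats 400000 in
set_option synthInstance.maxSize 2000 in
/-- The probability that the output of the BSG test has the property `E`. -/
def prBSGTest {n : ℕ} (r s T : ℕ) (ψ : Bits n → ℂ) (S : Finset (Vec n)) (u v : Vec n)
    (ζ₁ ζ₂ ζ₃ τ₁ τ₂ : ℝ) (E : ℕ → Prop) : ℝ :=
  ∑ ω : BSGRun n r s T, if E (bsgTest S u v ζ₁ ζ₂ ζ₃ τ₁ τ₂ ω) then bsgRunProb ψ S u v ω else 0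

end BSG

end

/-!
Every point of `S` has weight at least `γ / 4`, whereas all thresholds lie below `γ / 18`. Hence for
`u ∈ S` the neighbourhood of `u` is `{v ∈ S : u + v ∈ S}` whatever the threshold, and the sets
`A⁽¹⁾(u) ⊆ A⁽²⁾(u)` do not depend on the sub-interval (`IsGoodSet.setT_eq`): both are sets of
neighbours of `u` that have few common neighbours with only few neighbours of `u` (`richNbrs`), in
the Cayley sum graph of `S` with vertices weighted by `D`.

*Structure.* By Parseval's identity for the Weyl operators `p` is a probability distribution with
`p ≤ 2⁻ⁿ`, so `q ≤ 2⁻ⁿ`; conversely `q(x)` is at least `(γ / 4)² 4⁻ⁿ` times the degree of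
`x` in the graph. This gives `D(x) ≤ C₁ γ⁻¹⁰ / |S|` (`IsGoodSet.sampleDist_le`), and, since a dense
graph has many walks of length three, that two independent samples are adjacent with probability at
least `γ⁶⁴ / C₂` (`IsGoodSet.mean_prob_nbr_ge`). The Balog–Szemerédi–Gowers argument then applies. A
pair with few common neighbours rarely lies in the neighbourhood of a random `u`, so on average
`A⁽¹⁾(u)` has most of the mass of the neighbourhood (`mean_prob_richNbrs_ge`). Any two elements of
`A⁽²⁾(u)` are joined by many paths of length four, which write their sum as a sum of four elements
of `S` in many ways, so the sumset is small (`card_richNbrs_add_le`).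

*Test.* Measuring `W_g ⊗ W_g` on `ψ ⊗ ψ` has mean `2ⁿ p(g)` because `W_g` is Hermitian. For
`x, y ∈ S` the edge test therefore errs only if `x + y ∈ S` and some empirical mean falls `γ / 6`
below its expectation. A Chernoff bound controls this, as well as the deviations of the frequencies
in the samples `w` (margin `ρ₁ / 22`) and `z` (margin `ρ₂ / 18`). Outside these events the output is
right (`bsgTest_correct`), and a union bound over all samples and measurements costs only a
polynomial factor in front of exponentially small probabilities (`IsGoodSet.prBSGTest_ge`).
-/

namespace BSG

/-! ### Finite probability -/

section FiniteProbability

variable {α β ι : Type*} [Fintype α] [Fintype β] [Fintype ι]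

open Classical in
/-- The mass that the weight function `p` on a finite type gives to the event `E`. -/
noncomputable def prob (p : α → ℝ) (E : α → Prop) : ℝ := ∑ a, if E a then p a else 0

/-- `p` is the mass function of a probability measure. -/
structure IsPMF (p : α → ℝ) : Prop where
  nonneg : ∀ a, 0 ≤ p a
  sum_eq : ∑ a, p a = 1

lemma prob_congr {p : α → ℝ} {E F : α → Prop} (h : ∀ a, E a ↔ F a) : prob p E = prob p F := by
  rw [show E = F from funext fun a => propext (h a)]

lemma prob_mono_of_support {p : α → ℝ} (hp : ∀ a, 0 ≤ p a) {E F : α → Prop}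
    (h : ∀ a, p a ≠ 0 → E a → F a) : prob p E ≤ prob p F := by
  refine Finset.sum_le_sum fun a _ => ?_
  by_cases h0 : p a = 0
  · simp [h0]
  by_cases hE : E a
  · simp [hE, h a h0 hE]
  · simp only [hE, if_false]
    split_ifs
    exacts [hp a, le_rfl]

lemma prob_mono {p : α → ℝ} (hp : ∀ a, 0 ≤ p a) {E F : α → Prop} (h : ∀ a, E a → F a) :
    prob p E ≤ prob p F :=
  prob_mono_of_support hp fun a _ => h a

lemma prob_nonneg {p : α → ℝ} (hp : ∀ a, 0 ≤ p a) (E : α → Prop) : 0 ≤ prob p E :=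
  Finset.sum_nonneg fun a _ => by split_ifs; exacts [hp a, le_rfl]

lemma prob_true (p : α → ℝ) : prob p (fun _ => True) = ∑ a, p a := by simp [prob]

lemma prob_le_one {p : α → ℝ} (hp : IsPMF p) (E : α → Prop) : prob p E ≤ 1 := by
  rw [← hp.sum_eq, ← prob_true]
  exact prob_mono hp.nonneg fun _ _ => trivial

lemma prob_add_prob_not (p : α → ℝ) (E : α → Prop) :
    prob p E + prob p (fun a => ¬ E a) = ∑ a, p a := by
  rw [prob, prob, ← Finset.sum_add_distrib]
  refine Finset.sum_congr rfl fun a _ => ?_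
  by_cases h : E a <;> simp [h]

lemma prob_or_le {p : α → ℝ} (hp : ∀ a, 0 ≤ p a) (E F : α → Prop) :
    prob p (fun a => E a ∨ F a) ≤ prob p E + prob p F := by
  rw [prob, prob, prob, ← Finset.sum_add_distrib]
  refine Finset.sum_le_sum fun a _ => ?_
  have := hp a
  by_cases h : E a <;> by_cases h' : F a <;> simp [h, h', this]

lemma prob_and_ge {p : α → ℝ} (hp : IsPMF p) {E F : α → Prop} {ε₁ ε₂ : ℝ}
    (hE : 1 - ε₁ ≤ prob p E) (hF : 1 - ε₂ ≤ prob p F) :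
    1 - (ε₁ + ε₂) ≤ prob p (fun a => E a ∧ F a) := by
  have h1 := prob_add_prob_not p E
  have h2 := prob_add_prob_not p F
  have h3 := prob_add_prob_not p (fun a => E a ∧ F a)
  have h4 := prob_or_le hp.nonneg (fun a => ¬ E a) (fun a => ¬ F a)
  rw [prob_congr (F := fun a => ¬ E a ∨ ¬ F a) fun a => not_and_or] at h3
  rw [hp.sum_eq] at h1 h2 h3
  linarith

open Classical in
lemma prob_eq_sum_indicator (p : α → ℝ) (E : α → Prop) :
    prob p E = ∑ a, p a * (if E a then 1 else 0) := by
  simp [prob]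

/-- Two-stage experiments: first `a` with law `p`, then `b` with law `κ a`. -/
lemma prob_prod_ge {p : α → ℝ} {κ : α → β → ℝ} (hp : ∀ a, 0 ≤ p a) {E : α → Prop}
    {F : α → β → Prop} {ε₁ ε₂ : ℝ} (hε₁ : 0 ≤ ε₁) (hε₂ : 0 ≤ ε₂) (hκ : ∀ a b, 0 ≤ κ a b)
    (hE : 1 - ε₁ ≤ prob p E) (hF : ∀ a, E a → 1 - ε₂ ≤ prob (κ a) (F a)) :
    1 - (ε₁ + ε₂) ≤ prob (fun ab : α × β => p ab.1 * κ ab.1 ab.2)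
      (fun ab => E ab.1 ∧ F ab.1 ab.2) := by
  have h : prob (fun ab : α × β => p ab.1 * κ ab.1 ab.2) (fun ab => E ab.1 ∧ F ab.1 ab.2) =
      prob (fun a => p a * prob (κ a) (F a)) E := by
    simp only [prob, Fintype.sum_prod_type, Finset.mul_sum, mul_ite, mul_zero]
    refine Finset.sum_congr rfl fun a _ => ?_
    by_cases hE : E a
    · rw [if_pos hE]
      exact Finset.sum_congr rfl fun b _ => by by_cases hF : F a b <;> simp [hE, hF]
    · simp [hE]
  rw [h]
  by_cases h1 : 1 ≤ ε₂
  · have : 0 ≤ prob (fun a => p a * prob (κ a) (F a)) E :=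
      prob_nonneg (fun a => mul_nonneg (hp a) (prob_nonneg (hκ a) _)) _
    linarith
  have h2 : prob p E * (1 - ε₂) ≤ prob (fun a => p a * prob (κ a) (F a)) E := by
    rw [prob, prob, Finset.sum_mul]
    refine Finset.sum_le_sum fun a _ => ?_
    by_cases hEa : E a
    · simpa [hEa] using mul_le_mul_of_nonneg_left (hF a hEa) (hp a)
    · simp [hEa]
  nlinarith

lemma sum_prod_eq_prod_sum [DecidableEq ι] (p : ι → α → ℝ) :
    ∑ ω : ι → α, ∏ i, p i (ω i) = ∏ i, ∑ a, p i a := by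
  rw [Finset.prod_univ_sum, Fintype.piFinset_univ]

lemma isPMF_pi [DecidableEq ι] {p : ι → α → ℝ} (hp : ∀ i, IsPMF (p i)) :
    IsPMF (fun ω : ι → α => ∏ i, p i (ω i)) where
  nonneg ω := Finset.prod_nonneg fun i _ => (hp i).nonneg _
  sum_eq := by rw [sum_prod_eq_prod_sum]; exact Finset.prod_eq_one fun i _ => (hp i).sum_eq

/-- Independent events. -/
lemma prob_pi [DecidableEq ι] (p : ι → α → ℝ) (E : ι → α → Prop) :
    prob (fun ω : ι → α => ∏ i, p i (ω i)) (fun ω => ∀ i, E i (ω i)) = ∏ i, prob (p i) (E i) := by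
  classical
  simp only [prob]
  rw [← sum_prod_eq_prod_sum]
  refine Finset.sum_congr rfl fun ω _ => ?_
  rw [Finset.prod_ite_zero]
  simp

lemma prob_pi_ge [DecidableEq ι] {p : ι → α → ℝ} (hp : ∀ i, IsPMF (p i)) {E : ι → α → Prop}
    {ε : ℝ} (hE : ∀ i, 1 - ε ≤ prob (p i) (E i)) :
    1 - Fintype.card ι * ε ≤
      prob (fun ω : ι → α => ∏ i, p i (ω i)) (fun ω => ∀ i, E i (ω i)) := by
  rw [prob_pi]
  by_cases h : 1 ≤ ε
  · have h0 : 0 ≤ ∏ i, prob (p i) (E i) :=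
      Finset.prod_nonneg fun i _ => prob_nonneg (hp i).nonneg _
    rcases isEmpty_or_nonempty ι with hι | hι
    · simp
    · have : (1 : ℝ) ≤ Fintype.card ι := by exact_mod_cast Fintype.card_pos
      nlinarith
  · calc 1 - Fintype.card ι * ε = 1 + Fintype.card ι * (-ε) := by ring
      _ ≤ (1 + -ε) ^ Fintype.card ι := one_add_mul_le_pow (by linarith) _
      _ = ∏ _i : ι, (1 - ε) := by rw [Finset.prod_const, Finset.card_univ, ← sub_eq_add_neg]
      _ ≤ _ := Finset.prod_le_prod (fun _ _ => by linarith) fun i _ => hE i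

/-- The Chernoff bound for the lower tail: the exponential moment of `τ - f` with parameter `g / 8`
is at most `1 - g² / 16`, by `exp y ≤ 1 + y + y²` for `|y| ≤ 1`. -/
lemma prob_lt_sum_ge {p : α → ℝ} (hp : IsPMF p) {f : α → ℝ} (hf : ∀ a, |f a| ≤ 1) {τ g : ℝ}
    (hτ : |τ| ≤ 1) (hg : 0 ≤ g) (hmean : τ + g ≤ ∑ a, p a * f a) (N : ℕ) :
    1 - Real.exp (-(N * (g ^ 2 / 16))) ≤
      prob (fun ω : Fin N → α => ∏ i, p (ω i)) (fun ω => N * τ < ∑ i, f (ω i)) := by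
  have hp' := isPMF_pi (ι := Fin N) (p := fun _ => p) fun _ => hp
  have hτ' := abs_le.1 hτ
  have hf' := fun a => abs_le.1 (hf a)
  have hg2 : g ≤ 2 := by
    have : ∑ a, p a * f a ≤ ∑ a, p a :=
      Finset.sum_le_sum fun a _ => mul_le_of_le_one_right (hp.nonneg a) (hf' a).2
    rw [hp.sum_eq] at this
    linarith
  have hmom : ∑ a, p a * Real.exp (g / 8 * (τ - f a)) ≤ Real.exp (-(g ^ 2 / 16)) := by
    have hpt : ∀ a, Real.exp (g / 8 * (τ - f a)) ≤ 1 + g / 8 * (τ - f a) + g ^ 2 / 16 := by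
      intro a
      have hab : |τ - f a| ≤ 2 := abs_le.2 ⟨by linarith [(hf' a).2], by linarith [(hf' a).1]⟩
      have h1 : |g / 8 * (τ - f a)| ≤ 1 := by
        rw [abs_mul, abs_of_nonneg (by positivity)]
        nlinarith [abs_nonneg (τ - f a)]
      have h2 := (abs_le.1 (Real.abs_exp_sub_one_sub_id_le h1)).2
      have h3 : (g / 8 * (τ - f a)) ^ 2 ≤ g ^ 2 / 16 := by
        have : (τ - f a) ^ 2 ≤ 4 := by
          rw [← sq_abs]; nlinarith [abs_nonneg (τ - f a)]
        nlinarith [sq_nonneg g]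
      linarith
    calc ∑ a, p a * Real.exp (g / 8 * (τ - f a))
        ≤ ∑ a, p a * (1 + g / 8 * (τ - f a) + g ^ 2 / 16) :=
          Finset.sum_le_sum fun a _ => mul_le_mul_of_nonneg_left (hpt a) (hp.nonneg a)
      _ = (1 + g / 8 * τ + g ^ 2 / 16) * ∑ a, p a - g / 8 * ∑ a, p a * f a := by
          rw [Finset.mul_sum, Finset.mul_sum, ← Finset.sum_sub_distrib]
          exact Finset.sum_congr rfl fun a _ => by ring
      _ ≤ -(g ^ 2 / 16) + 1 := by rw [hp.sum_eq]; nlinarith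
      _ ≤ _ := Real.add_one_le_exp _
  have hbad : prob (fun ω : Fin N → α => ∏ i, p (ω i)) (fun ω => ¬ N * τ < ∑ i, f (ω i)) ≤
      Real.exp (-(N * (g ^ 2 / 16))) := by
    calc _ ≤ ∑ ω : Fin N → α, ∏ i, (p (ω i) * Real.exp (g / 8 * (τ - f (ω i)))) := by
          refine Finset.sum_le_sum fun ω _ => ?_
          have h0 : 0 ≤ ∏ i, p (ω i) := hp'.nonneg ω
          rw [Finset.prod_mul_distrib, ← Real.exp_sum, ← Finset.mul_sum, Finset.sum_sub_distrib]
          simp only [Finset.sum_const, Finset.card_univ, Fintype.card_fin, nsmul_eq_mul]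
          split_ifs with h
          · exact mul_nonneg h0 (Real.exp_nonneg _)
          · refine le_mul_of_one_le_right h0 (Real.one_le_exp ?_)
            exact mul_nonneg (by positivity) (by linarith)
      _ = (∑ a, p a * Real.exp (g / 8 * (τ - f a))) ^ N := by
          rw [sum_prod_eq_prod_sum (fun (_ : Fin N) a => p a * Real.exp (g / 8 * (τ - f a)))]
          simp
      _ ≤ Real.exp (-(g ^ 2 / 16)) ^ N :=
          pow_le_pow_left₀ (Finset.sum_nonneg fun a _ =>
            mul_nonneg (hp.nonneg a) (Real.exp_nonneg _)) hmom N
      _ = _ := by rw [← Real.exp_nat_mul]; ring_nf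
  have := prob_add_prob_not (fun ω : Fin N → α => ∏ i, p (ω i)) (fun ω => N * τ < ∑ i, f (ω i))
  rw [hp'.sum_eq] at this
  linarith

/-- The Chernoff bound for the upper tail. -/
lemma prob_sum_lt_ge {p : α → ℝ} (hp : IsPMF p) {f : α → ℝ} (hf : ∀ a, |f a| ≤ 1) {τ g : ℝ}
    (hτ : |τ| ≤ 1) (hg : 0 ≤ g) (hmean : ∑ a, p a * f a ≤ τ - g) (N : ℕ) :
    1 - Real.exp (-(N * (g ^ 2 / 16))) ≤
      prob (fun ω : Fin N → α => ∏ i, p (ω i)) (fun ω => ∑ i, f (ω i) < N * τ) := by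
  have h := prob_lt_sum_ge hp (f := fun a => - f a) (τ := -τ) (g := g) (by simpa using hf)
    (by simpa using hτ) hg (by simp only [mul_neg, Finset.sum_neg_distrib]; linarith) N
  simpa using h

end FiniteProbability

/-! ### Weyl operators -/

section Weyl

variable {n : ℕ}

lemma zmodTwo_forall {P : ZMod 2 → Prop} (h0 : P 0) (h1 : P 1) (a : ZMod 2) : P a := by
  fin_cases a
  exacts [h0, h1]

/-- The entries of the one-qubit Weyl operators. -/
lemma pauli_apply (a b s t : ZMod 2) :
    (pauliX ^ a.val * pauliZ ^ b.val) s t =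
      if s = t + a then (-1 : ℂ) ^ (b.val * t.val) else 0 := by
  have hX : ∀ s t, pauliX s t = if s = t + 1 then 1 else 0 := fun _ _ => rfl
  revert a b s t
  have e : (1 : ZMod 2) + 1 = 0 := by decide
  have v : (1 : ZMod 2).val = 1 := by decide
  refine zmodTwo_forall ?_ ?_ <;> refine zmodTwo_forall ?_ ?_ <;>
    refine zmodTwo_forall ?_ ?_ <;> refine zmodTwo_forall ?_ ?_ <;>
    simp [hX, e, v, pauliZ, Matrix.mul_diagonal]

/-- The character `z ↦ (-1)^(b·z)`. -/
noncomputable def signChar (b z : Bits n) : ℂ := ∏ i, (-1 : ℂ) ^ ((b i).val * (z i).val)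

lemma weyl_apply (x : Vec n) (y z : Bits n) :
    weyl x y z = if y = z + x.1 then
      Complex.I ^ (∑ i, (x.1 i).val * (x.2 i).val) * signChar x.2 z else 0 := by
  simp only [weyl, Matrix.of_apply, pauli_apply, signChar]
  rw [Finset.prod_ite_zero]
  by_cases h : y = z + x.1
  · simp [h]
  · rw [if_neg h, if_neg, mul_zero]
    intro h'
    exact h (funext fun i => h' i (Finset.mem_univ i))

lemma isHermitian_weyl (x : Vec n) : (weyl x).IsHermitian := by
  have hq : ∀ a b s t : ZMod 2,
      star (Complex.I ^ (a.val * b.val) * (pauliX ^ a.val * pauliZ ^ b.val) t s) =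
        Complex.I ^ (a.val * b.val) * (pauliX ^ a.val * pauliZ ^ b.val) s t := by
    have e : (1 : ZMod 2) + 1 = 0 := by decide
    have v : (1 : ZMod 2).val = 1 := by decide
    simp only [pauli_apply]
    refine zmodTwo_forall ?_ ?_ <;> refine zmodTwo_forall ?_ ?_ <;>
    refine zmodTwo_forall ?_ ?_ <;> refine zmodTwo_forall ?_ ?_ <;>
      simp [e, v]
  have hw : ∀ y z, weyl x y z = ∏ i, (Complex.I ^ ((x.1 i).val * (x.2 i).val) *
      (pauliX ^ (x.1 i).val * pauliZ ^ (x.2 i).val) (y i) (z i)) := by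
    intro y z
    rw [Finset.prod_mul_distrib, Finset.prod_pow_eq_pow_sum]
    rfl
  ext y z
  rw [Matrix.conjTranspose_apply, hw, hw, star_prod]
  exact Finset.prod_congr rfl fun i _ => hq _ _ _ _

/-- `⟨ψ|W_x|ψ⟩`. -/
noncomputable def expect (ψ : Bits n → ℂ) (x : Vec n) : ℂ := star ψ ⬝ᵥ (weyl x *ᵥ ψ)

lemma expect_eq (ψ : Bits n → ℂ) (x : Vec n) :
    expect ψ x = Complex.I ^ (∑ i, (x.1 i).val * (x.2 i).val) *
      ∑ z, star (ψ (z + x.1)) * ψ z * signChar x.2 z := by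
  simp only [expect, dotProduct, Matrix.mulVec, weyl_apply, Finset.mul_sum, Pi.star_apply]
  rw [Finset.sum_comm]
  refine Finset.sum_congr rfl fun z _ => ?_
  rw [Finset.sum_eq_single (z + x.1)]
  · simp; ring
  · intro y _ hy; simp [hy]
  · simp

lemma star_expect (ψ : Bits n → ℂ) (x : Vec n) : star (expect ψ x) = expect ψ x := by
  rw [expect, ← Matrix.star_dotProduct_star, star_star, Matrix.star_mulVec,
    (isHermitian_weyl x).eq, Matrix.dotProduct_mulVec]

lemma norm_signChar (b z : Bits n) : ‖signChar b z‖ = 1 := by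
  simp [signChar, norm_prod]

lemma star_signChar (b z : Bits n) : star (signChar b z) = signChar b z := by
  simp [signChar]

lemma norm_expect (ψ : Bits n → ℂ) (x : Vec n) :
    ‖expect ψ x‖ = ‖∑ z, star (ψ (z + x.1)) * ψ z * signChar x.2 z‖ := by
  rw [expect_eq, norm_mul, norm_pow, Complex.norm_I, one_pow, one_mul]

lemma sum_signChar_mul (z z' : Bits n) :
    ∑ b, signChar b z * signChar b z' = if z = z' then (2 : ℂ) ^ n else 0 := by
  have h1 : ∀ s t : ZMod 2, ∑ b : ZMod 2, (-1 : ℂ) ^ (b.val * s.val) * (-1) ^ (b.val * t.val) =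
      if s = t then 2 else 0 := by
    have v : (1 : ZMod 2).val = 1 := by decide
    have hs : ∀ f : ZMod 2 → ℂ, ∑ b, f b = f 0 + f 1 := Fin.sum_univ_two
    refine zmodTwo_forall ?_ ?_ <;> refine zmodTwo_forall ?_ ?_ <;> simp [hs, v] <;> norm_num
  simp only [signChar, ← Finset.prod_mul_distrib]
  have h := Finset.prod_univ_sum (fun _ : Fin n => (Finset.univ : Finset (ZMod 2)))
    (fun i b => (-1 : ℂ) ^ (b.val * (z i).val) * (-1) ^ (b.val * (z' i).val))
  rw [Fintype.piFinset_univ] at h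
  rw [← h]
  simp only [h1]
  rw [Finset.prod_ite_zero]
  simp [funext_iff]

/-- Parseval's identity for the characters of `𝔽₂ⁿ`. -/
lemma sum_norm_sq_transform (f : Bits n → ℂ) :
    ∑ b, ‖∑ z, f z * signChar b z‖ ^ 2 = 2 ^ n * ∑ z, ‖f z‖ ^ 2 := by
  have h : ∑ b, (∑ z, f z * signChar b z) * star (∑ z, f z * signChar b z) =
      2 ^ n * ∑ z, f z * star (f z) := by
    calc ∑ b, (∑ z, f z * signChar b z) * star (∑ z, f z * signChar b z)
        = ∑ b, ∑ z, ∑ z', f z * star (f z') * (signChar b z * signChar b z') := by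
          refine Finset.sum_congr rfl fun b _ => ?_
          rw [star_sum, Finset.sum_mul_sum]
          refine Finset.sum_congr rfl fun z _ => Finset.sum_congr rfl fun z' _ => ?_
          rw [star_mul, star_signChar]; ring
      _ = ∑ z, ∑ z', f z * star (f z') * ∑ b, signChar b z * signChar b z' := by
          rw [Finset.sum_comm]
          refine Finset.sum_congr rfl fun z _ => ?_
          rw [Finset.sum_comm]
          simp only [Finset.mul_sum]
      _ = _ := by
          simp only [sum_signChar_mul, mul_ite, mul_zero, Finset.sum_ite_eq, Finset.mem_univ,
            if_true, Finset.mul_sum]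
          exact Finset.sum_congr rfl fun z _ => by ring
  have hn : ∀ w : ℂ, w * star w = ((‖w‖ ^ 2 : ℝ) : ℂ) := fun w => by
    rw [Complex.ofReal_pow]; exact Complex.mul_conj' w
  simp only [hn] at h
  exact_mod_cast h

lemma weight_eq (ψ : Bits n → ℂ) (x : Vec n) : weight ψ x = ‖expect ψ x‖ ^ 2 := by
  rw [weight, charDist, expect]
  field_simp

lemma charDist_eq (ψ : Bits n → ℂ) (x : Vec n) : charDist ψ x = weight ψ x / 2 ^ n := by
  rw [weight]; field_simp

lemma charDist_nonneg (ψ : Bits n → ℂ) (x : Vec n) : 0 ≤ charDist ψ x := by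
  rw [charDist]; positivity

lemma weight_nonneg (ψ : Bits n → ℂ) (x : Vec n) : 0 ≤ weight ψ x := by
  rw [weight_eq]; positivity

lemma weight_le_one {ψ : Bits n → ℂ} (hψ : IsState ψ) (x : Vec n) : weight ψ x ≤ 1 := by
  have h : ‖expect ψ x‖ ≤ 1 := by
    rw [norm_expect]
    calc ‖∑ z, star (ψ (z + x.1)) * ψ z * signChar x.2 z‖
        ≤ ∑ z, ‖ψ (z + x.1)‖ * ‖ψ z‖ := by
          refine (norm_sum_le _ _).trans (Finset.sum_le_sum fun z _ => ?_)
          rw [norm_mul, norm_mul, norm_signChar, norm_star, mul_one]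
      _ ≤ ∑ z, (‖ψ (z + x.1)‖ ^ 2 / 2 + ‖ψ z‖ ^ 2 / 2) :=
          Finset.sum_le_sum fun z _ => by nlinarith [sq_nonneg (‖ψ (z + x.1)‖ - ‖ψ z‖)]
      _ = 1 := by
          have h1 : ∑ z, ‖ψ z‖ ^ 2 = 1 := hψ
          have h2 : ∑ z, ‖ψ (z + x.1)‖ ^ 2 = 1 :=
            (Equiv.sum_comp (Equiv.addRight x.1) (fun z => ‖ψ z‖ ^ 2)).trans hψ
          rw [Finset.sum_add_distrib, ← Finset.sum_div, ← Finset.sum_div, h1, h2]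
          norm_num
  rw [weight_eq]
  exact pow_le_one₀ (norm_nonneg _) h

/-- The characteristic distribution of a state has total mass one: Parseval's identity in the
coordinate `b` of `x = (a, b)`, for each fixed `a`. -/
lemma sum_charDist {ψ : Bits n → ℂ} (hψ : IsState ψ) : ∑ x, charDist ψ x = 1 := by
  have h : ∑ x, ‖expect ψ x‖ ^ 2 = 2 ^ n := by
    simp only [norm_expect]
    rw [Fintype.sum_prod_type]
    simp only [sum_norm_sq_transform, ← Finset.mul_sum]
    rw [Finset.sum_comm]
    simp only [norm_mul, norm_star, mul_pow, ← Finset.sum_mul]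
    have hz : ∀ z : Bits n, ∑ a, ‖ψ (z + a)‖ ^ 2 = 1 := fun z =>
      (Equiv.sum_comp (Equiv.addLeft z) (fun z => ‖ψ z‖ ^ 2)).trans hψ
    simp only [hz, one_mul]
    rw [show ∑ z, ‖ψ z‖ ^ 2 = 1 from hψ, mul_one]
  simp only [charDist_eq, weight_eq, ← Finset.sum_div, h]
  field_simp

lemma weylDist_nonneg (ψ : Bits n → ℂ) (x : Vec n) : 0 ≤ weylDist ψ x :=
  Finset.sum_nonneg fun _ _ => mul_nonneg (charDist_nonneg _ _) (charDist_nonneg _ _)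

lemma sum_weylDist {ψ : Bits n → ℂ} (hψ : IsState ψ) : ∑ x, weylDist ψ x = 1 := by
  simp only [weylDist]
  rw [Finset.sum_comm]
  simp only [← Finset.mul_sum]
  have hy : ∀ y : Vec n, ∑ x, charDist ψ (x + y) = 1 := fun y =>
    (Equiv.sum_comp (Equiv.addRight y) (charDist ψ)).trans (sum_charDist hψ)
  simp only [hy, mul_one]
  exact sum_charDist hψ

lemma weylDist_le {ψ : Bits n → ℂ} (hψ : IsState ψ) (x : Vec n) :
    weylDist ψ x ≤ 1 / 2 ^ n := by
  calc weylDist ψ x ≤ ∑ y, charDist ψ y * (1 / 2 ^ n) := by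
        refine Finset.sum_le_sum fun y _ => mul_le_mul_of_nonneg_left ?_ (charDist_nonneg _ _)
        rw [charDist_eq]
        gcongr
        exact weight_le_one hψ _
    _ = 1 / 2 ^ n := by rw [← Finset.sum_mul, sum_charDist hψ, one_mul]

/-- Measuring `W_x ⊗ W_x` on `ψ ⊗ ψ` reports an eigenvalue of mean `2ⁿ p(x)`. -/
lemma outcomeProb_eq {ψ : Bits n → ℂ} (hψ : IsState ψ) (x : Vec n) (b : Bool) :
    outcomeProb ψ x b = (1 + eigenvalue b * weight ψ x) / 2 := by
  have h1 : star (twoCopies ψ) ⬝ᵥ twoCopies ψ = 1 := by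
    have hs : ∑ y, star (ψ y) * ψ y = 1 := by
      have : ∑ y, ((‖ψ y‖ ^ 2 : ℝ) : ℂ) = 1 := by
        rw [← Complex.ofReal_sum, show ∑ y, ‖ψ y‖ ^ 2 = 1 from hψ]; simp
      rw [← this]
      refine Finset.sum_congr rfl fun y _ => ?_
      rw [Complex.ofReal_pow]
      exact Complex.conj_mul' _
    calc star (twoCopies ψ) ⬝ᵥ twoCopies ψ
        = (∑ y, star (ψ y) * ψ y) * ∑ y, star (ψ y) * ψ y := by
          rw [Finset.sum_mul_sum, dotProduct, Fintype.sum_prod_type]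
          refine Finset.sum_congr rfl fun y _ => Finset.sum_congr rfl fun z _ => ?_
          simp [twoCopies]; ring
      _ = 1 := by rw [hs, one_mul]
  have h2 : star (twoCopies ψ) ⬝ᵥ ((weyl x ⊗ₖ weyl x) *ᵥ twoCopies ψ) =
      expect ψ x * expect ψ x := by
    have hv : (weyl x ⊗ₖ weyl x) *ᵥ twoCopies ψ =
        fun y => (weyl x *ᵥ ψ) y.1 * (weyl x *ᵥ ψ) y.2 := by
      funext y
      simp only [Matrix.mulVec, dotProduct]
      rw [Finset.sum_mul_sum, Fintype.sum_prod_type]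
      refine Finset.sum_congr rfl fun _ _ => Finset.sum_congr rfl fun _ _ => ?_
      simp [twoCopies, Matrix.kroneckerMap_apply]; ring
    rw [hv, expect]
    simp only [dotProduct]
    rw [Finset.sum_mul_sum, Fintype.sum_prod_type]
    refine Finset.sum_congr rfl fun _ _ => Finset.sum_congr rfl fun _ _ => ?_
    simp [twoCopies]; ring
  have h3 : expect ψ x * expect ψ x = (weight ψ x : ℂ) := by
    rw [weight_eq, Complex.ofReal_pow]
    nth_rewrite 2 [← star_expect]
    exact Complex.mul_conj' _
  rw [outcomeProb, eigenprojector, Matrix.smul_mulVec, Matrix.add_mulVec, Matrix.one_mulVec,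
    Matrix.smul_mulVec, dotProduct_smul, dotProduct_add, dotProduct_smul, h1, h2, h3]
  have : (1 / 2 : ℂ) • (1 + (eigenvalue b : ℂ) • (weight ψ x : ℂ)) =
      (((1 + eigenvalue b * weight ψ x) / 2 : ℝ) : ℂ) := by
    push_cast; simp only [smul_eq_mul]; ring
  rw [this, Complex.ofReal_re]

lemma isPMF_outcomeProb {ψ : Bits n → ℂ} (hψ : IsState ψ) (x : Vec n) :
    IsPMF (outcomeProb ψ x) where
  nonneg b := by
    have h0 := weight_nonneg ψ x
    have h1 := weight_le_one hψ x
    rw [outcomeProb_eq hψ]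
    cases b <;> simp [eigenvalue] <;> linarith
  sum_eq := by
    simp only [outcomeProb_eq hψ, Fintype.sum_bool, eigenvalue]
    norm_num
    ring

lemma mean_outcomeProb {ψ : Bits n → ℂ} (hψ : IsState ψ) (x : Vec n) :
    ∑ b, outcomeProb ψ x b * eigenvalue b = weight ψ x := by
  simp only [outcomeProb_eq hψ, Fintype.sum_bool, eigenvalue]
  norm_num
  ring

end Weyl

/-! ### The Balog–Szemerédi–Gowers argument -/

section Graph

variable {G : Type*} [AddCommGroup G] [Fintype G]

/-- `v` is a neighbour of `u` in the Cayley sum graph of `S` on the vertex set `S`. -/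
def Nbr (S : Finset G) (u v : G) : Prop := v ∈ S ∧ u + v ∈ S

/-- The probability that a random vertex is a common neighbour of `v` and `w`. -/
noncomputable def codeg (D : G → ℝ) (S : Finset G) (v w : G) : ℝ :=
  prob D fun x => Nbr S v x ∧ Nbr S w x

/-- The probability that a random vertex is a neighbour of `u` and has few common neighbours
with `v`. -/
noncomputable def badMass (D : G → ℝ) (S : Finset G) (ρ : ℝ) (u v : G) : ℝ :=
  prob D fun w => Nbr S u w ∧ codeg D S v w ≤ ρ

open Classical in
/-- The neighbours of `u` that have few common neighbours with only a few neighbours of `u`. -/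
noncomputable def richNbrs (D : G → ℝ) (S : Finset G) (ρ₁ ρ₂ : ℝ) (u : G) : Finset G :=
  Finset.univ.filter fun v => Nbr S u v ∧ badMass D S ρ₁ u v ≤ ρ₂

lemma mem_richNbrs {D : G → ℝ} {S : Finset G} {ρ₁ ρ₂ : ℝ} {u v : G} :
    v ∈ richNbrs D S ρ₁ ρ₂ u ↔ Nbr S u v ∧ badMass D S ρ₁ u v ≤ ρ₂ := by
  simp [richNbrs]

lemma badMass_mono {D : G → ℝ} (hD : ∀ x, 0 ≤ D x) {S : Finset G} {ρ ρ' : ℝ} (h : ρ ≤ ρ')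
    (u v : G) : badMass D S ρ u v ≤ badMass D S ρ' u v :=
  prob_mono hD fun _ hw => ⟨hw.1, hw.2.trans h⟩

lemma richNbrs_mono {D : G → ℝ} (hD : ∀ x, 0 ≤ D x) {S : Finset G} {ρ₁ ρ₁' ρ₂ ρ₂' : ℝ}
    (h₁ : ρ₁' ≤ ρ₁) (h₂ : ρ₂ ≤ ρ₂') (u : G) :
    richNbrs D S ρ₁ ρ₂ u ⊆ richNbrs D S ρ₁' ρ₂' u := fun v hv => by
  rw [mem_richNbrs] at hv ⊢
  exact ⟨hv.1, (badMass_mono hD h₁ u v).trans (hv.2.trans h₂)⟩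

/-- Markov's inequality, in the form that a variable bounded by one exceeds half its mean with
probability at least half its mean. -/
lemma prob_half_mean_le {α : Type*} [Fintype α] {p : α → ℝ} (hp : IsPMF p) {X : α → ℝ}
    (hX : ∀ a, X a ≤ 1) {b : ℝ} (hb : 0 ≤ b) (hmean : b ≤ ∑ a, p a * X a) :
    b / 2 ≤ prob p fun a => b / 2 ≤ X a := by
  have h : ∑ a, p a * X a ≤ ∑ a, ((if b / 2 ≤ X a then p a else 0) + p a * (b / 2)) := by
    refine Finset.sum_le_sum fun a _ => ?_
    have := hp.nonneg a
    split_ifs with h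
    · nlinarith [hX a]
    · nlinarith [not_le.1 h]
  rw [Finset.sum_add_distrib, ← Finset.sum_mul, hp.sum_eq] at h
  have h' : prob p (fun a => b / 2 ≤ X a) = ∑ a, if b / 2 ≤ X a then p a else 0 := by
    rw [prob]
  linarith

open Classical in
/-- On average over `u`, the rich neighbours of `u` have almost the mass of all neighbours: a
pair with few common neighbours is rarely contained in the neighbourhood of a random `u`. -/
lemma mean_prob_richNbrs_ge {D : G → ℝ} (hD : IsPMF D) {S : Finset G}
    (hDS : ∀ x, x ∉ S → D x = 0) {ρ₁ ρ₂ : ℝ} (h₁ : 0 ≤ ρ₁) (h₂ : 0 < ρ₂) :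
    ∑ u, D u * prob D (Nbr S u) - ρ₁ / ρ₂ ≤
      ∑ u, D u * prob D (fun v => v ∈ richNbrs D S ρ₁ ρ₂ u) := by
  have hpt : ∀ u, prob D (Nbr S u) ≤ prob D (fun v => v ∈ richNbrs D S ρ₁ ρ₂ u) +
      (∑ v, D v * ((if Nbr S u v then 1 else 0) * badMass D S ρ₁ u v)) / ρ₂ := by
    intro u
    rw [prob, prob, Finset.sum_div, ← Finset.sum_add_distrib]
    refine Finset.sum_le_sum fun v _ => ?_
    have hv := hD.nonneg v
    have hb : 0 ≤ badMass D S ρ₁ u v := prob_nonneg hD.nonneg _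
    by_cases hN : Nbr S u v
    · by_cases hr : badMass D S ρ₁ u v ≤ ρ₂
      · have : v ∈ richNbrs D S ρ₁ ρ₂ u := mem_richNbrs.2 ⟨hN, hr⟩
        simp only [hN, this, if_true, one_mul]
        have : 0 ≤ D v * badMass D S ρ₁ u v / ρ₂ := by positivity
        linarith
      · have : v ∉ richNbrs D S ρ₁ ρ₂ u := fun h => hr (mem_richNbrs.1 h).2
        simp only [hN, this, if_true, if_false, one_mul, zero_add]
        rw [le_div_iff₀ h₂]
        exact mul_le_mul_of_nonneg_left (not_le.1 hr).le hv
    · have : v ∉ richNbrs D S ρ₁ ρ₂ u := fun h => hN (mem_richNbrs.1 h).1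
      simp [hN, this]
  have hbad : ∑ u, D u * ∑ v, D v * ((if Nbr S u v then 1 else 0) * badMass D S ρ₁ u v) ≤ ρ₁ := by
    calc _ = ∑ u, ∑ v, ∑ w, D v * D w * (if codeg D S v w ≤ ρ₁ then 1 else 0) *
            (D u * (if Nbr S u v ∧ Nbr S u w then 1 else 0)) := by
          simp only [badMass, prob_eq_sum_indicator, Finset.mul_sum]
          refine Finset.sum_congr rfl fun u _ => Finset.sum_congr rfl fun v _ =>
            Finset.sum_congr rfl fun w _ => ?_
          by_cases h1 : Nbr S u v <;> by_cases h2 : Nbr S u w <;>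
            by_cases h3 : codeg D S v w ≤ ρ₁ <;> simp [h1, h2, h3]
          ring
      _ = ∑ v, ∑ w, D v * D w * (if codeg D S v w ≤ ρ₁ then 1 else 0) *
            ∑ u, D u * (if Nbr S u v ∧ Nbr S u w then 1 else 0) := by
          rw [Finset.sum_comm]
          refine Finset.sum_congr rfl fun v _ => ?_
          rw [Finset.sum_comm]
          simp only [Finset.mul_sum]
      _ ≤ ∑ v, ∑ w, D v * D w * ρ₁ := by
          refine Finset.sum_le_sum fun v _ => Finset.sum_le_sum fun w _ => ?_
          have hvw : 0 ≤ D v * D w := mul_nonneg (hD.nonneg v) (hD.nonneg w)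
          have hc : ∑ u, D u * (if Nbr S u v ∧ Nbr S u w then 1 else 0) ≤ codeg D S v w := by
            rw [codeg, prob_eq_sum_indicator]
            refine Finset.sum_le_sum fun u _ => ?_
            by_cases hu : u ∈ S
            · refine mul_le_mul_of_nonneg_left ?_ (hD.nonneg u)
              by_cases h : Nbr S u v ∧ Nbr S u w
              · have : Nbr S v u ∧ Nbr S w u :=
                  ⟨⟨hu, add_comm u v ▸ h.1.2⟩, ⟨hu, add_comm u w ▸ h.2.2⟩⟩
                simp [h, this]
              · rw [if_neg h]; split_ifs <;> norm_num
            · simp [hDS u hu]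
          split_ifs with h
          · rw [mul_one]; exact mul_le_mul_of_nonneg_left (hc.trans h) hvw
          · rw [mul_zero, zero_mul]; exact mul_nonneg hvw h₁
      _ = ρ₁ := by
          simp only [← Finset.sum_mul, ← Finset.mul_sum, hD.sum_eq, mul_one, one_mul]
  have hsum : ∑ u, D u * prob D (Nbr S u) ≤
      ∑ u, D u * prob D (fun v => v ∈ richNbrs D S ρ₁ ρ₂ u) +
      (∑ u, D u * ∑ v, D v * ((if Nbr S u v then 1 else 0) * badMass D S ρ₁ u v)) / ρ₂ := by
    rw [Finset.sum_div, ← Finset.sum_add_distrib]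
    refine Finset.sum_le_sum fun u _ => ?_
    rw [mul_div_assoc, ← mul_add]
    exact mul_le_mul_of_nonneg_left (hpt u) (hD.nonneg u)
  have := div_le_div_of_nonneg_right hbad h₂.le
  linarith

lemma prob_mem_le {α : Type*} [Fintype α] {D : α → ℝ} {B : ℝ} (hB : ∀ x, D x ≤ B) (A : Finset α) :
    prob D (fun x => x ∈ A) ≤ A.card * B := by
  calc prob D (fun x => x ∈ A) = ∑ x ∈ A, D x := by
        rw [prob, ← Finset.sum_subset (Finset.subset_univ A) fun x _ hx => if_neg hx]
        exact Finset.sum_congr rfl fun x hx => if_pos hx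
    _ ≤ _ := by simpa using Finset.sum_le_card_nsmul A D B fun x _ => hB x

open Classical in
/-- The number of triples `(x, w, y)` for which all steps of the path `v, x, w, y, v'` have their
sums in `S`. -/
noncomputable def pathTriples (S : Finset G) (v v' : G) : Finset (G × G × G) :=
  Finset.univ.filter fun t =>
    v + t.1 ∈ S ∧ t.2.1 + t.1 ∈ S ∧ t.2.1 + t.2.2 ∈ S ∧ v' + t.2.2 ∈ S

open Classical in
/-- Two rich neighbours of `u` are joined by many paths of length four, as most neighbours `w` of
`u` have many common neighbours with both. -/
lemma card_pathTriples_ge {D : G → ℝ} (hD : IsPMF D) {S : Finset G} {ρ₁ ρ₂ B : ℝ}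
    (h₁ : 0 ≤ ρ₁) (hB : ∀ x, D x ≤ B) {u v v' : G}
    (hv : v ∈ richNbrs D S ρ₁ ρ₂ u) (hv' : v' ∈ richNbrs D S ρ₁ ρ₂ u) :
    (prob D (Nbr S u) - 2 * ρ₂) * ρ₁ ^ 2 ≤ (pathTriples S v v').card * B ^ 3 := by
  have hB0 : ∀ x, 0 ≤ D x := hD.nonneg
  have hgood : prob D (Nbr S u) - 2 * ρ₂ ≤
      prob D fun w => ρ₁ < codeg D S v w ∧ ρ₁ < codeg D S v' w := by
    have h1 : prob D (Nbr S u) ≤ prob D (fun w =>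
        ((ρ₁ < codeg D S v w ∧ ρ₁ < codeg D S v' w) ∨ (Nbr S u w ∧ codeg D S v w ≤ ρ₁)) ∨
          (Nbr S u w ∧ codeg D S v' w ≤ ρ₁)) := by
      refine prob_mono hB0 fun w hw => ?_
      rcases le_or_gt (codeg D S v w) ρ₁ with h | h
      · exact Or.inl (Or.inr ⟨hw, h⟩)
      rcases le_or_gt (codeg D S v' w) ρ₁ with h' | h'
      · exact Or.inr ⟨hw, h'⟩
      · exact Or.inl (Or.inl ⟨h, h'⟩)
    have h2 := prob_or_le hB0 (fun w =>
        (ρ₁ < codeg D S v w ∧ ρ₁ < codeg D S v' w) ∨ (Nbr S u w ∧ codeg D S v w ≤ ρ₁))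
          (fun w => Nbr S u w ∧ codeg D S v' w ≤ ρ₁)
    have h3 := prob_or_le hB0 (fun w =>
        (ρ₁ < codeg D S v w ∧ ρ₁ < codeg D S v' w)) (fun w => Nbr S u w ∧ codeg D S v w ≤ ρ₁)
    have h4 : badMass D S ρ₁ u v ≤ ρ₂ := (mem_richNbrs.1 hv).2
    have h5 : badMass D S ρ₁ u v' ≤ ρ₂ := (mem_richNbrs.1 hv').2
    rw [badMass] at h4 h5
    linarith
  have hmass : (prob D fun w => ρ₁ < codeg D S v w ∧ ρ₁ < codeg D S v' w) * ρ₁ ^ 2 ≤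
      ∑ w, D w * (codeg D S v w * codeg D S v' w) := by
    rw [prob, Finset.sum_mul]
    refine Finset.sum_le_sum fun w _ => ?_
    have c1 : 0 ≤ codeg D S v w := prob_nonneg hB0 _
    have c2 : 0 ≤ codeg D S v' w := prob_nonneg hB0 _
    split_ifs with h
    · refine mul_le_mul_of_nonneg_left ?_ (hB0 w)
      rw [sq]
      exact mul_le_mul h.1.le h.2.le h₁ c1
    · rw [zero_mul]; exact mul_nonneg (hB0 w) (mul_nonneg c1 c2)
  have hcount : ∑ w, D w * (codeg D S v w * codeg D S v' w) ≤
      (pathTriples S v v').card * B ^ 3 := by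
    calc ∑ w, D w * (codeg D S v w * codeg D S v' w)
        = ∑ w, ∑ x, ∑ y, D w * D x * D y *
            (if (Nbr S v x ∧ Nbr S w x) ∧ (Nbr S v' y ∧ Nbr S w y) then 1 else 0) := by
          simp only [codeg, prob_eq_sum_indicator]
          refine Finset.sum_congr rfl fun w _ => ?_
          rw [Finset.sum_mul_sum, Finset.mul_sum]
          refine Finset.sum_congr rfl fun x _ => ?_
          rw [Finset.mul_sum]
          refine Finset.sum_congr rfl fun y _ => ?_
          by_cases h1 : Nbr S v x ∧ Nbr S w x <;> by_cases h2 : Nbr S v' y ∧ Nbr S w y <;>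
            simp only [h1, h2, and_self, and_true, and_false, if_true, if_false] <;> ring
      _ ≤ ∑ w, ∑ x, ∑ y, if (x, w, y) ∈ pathTriples S v v' then B ^ 3 else 0 := by
          refine Finset.sum_le_sum fun w _ => Finset.sum_le_sum fun x _ =>
            Finset.sum_le_sum fun y _ => ?_
          have hB' : 0 ≤ B := (hB0 w).trans (hB w)
          by_cases h : (Nbr S v x ∧ Nbr S w x) ∧ (Nbr S v' y ∧ Nbr S w y)
          · have hm : (x, w, y) ∈ pathTriples S v v' := by
              simp only [pathTriples, Finset.mem_filter, Finset.mem_univ, true_and]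
              exact ⟨h.1.1.2, h.1.2.2, h.2.2.2, h.2.1.2⟩
            rw [if_pos h, if_pos hm, mul_one, pow_three, ← mul_assoc]
            have := hB0 x
            have := hB0 y
            have := hB0 w
            gcongr <;> exact hB _
          · rw [if_neg h, mul_zero]
            split_ifs <;> positivity
      _ = ∑ t : G × G × G, if t ∈ pathTriples S v v' then B ^ 3 else 0 := by
          rw [Finset.sum_comm, Fintype.sum_prod_type]
          simp only [Fintype.sum_prod_type]
      _ = _ := by
          rw [← Finset.sum_filter, Finset.filter_univ_mem, Finset.sum_const, nsmul_eq_mul]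
  calc _ ≤ _ := mul_le_mul_of_nonneg_right hgood (sq_nonneg ρ₁)
    _ ≤ _ := hmass.trans hcount

/-- A path of length four from `v` to `v'` writes `v + v'` as a sum of four elements of `S`, and
the path can be recovered from the four summands and `v`. -/
lemma card_pathTriples_le [Module (ZMod 2) G] [DecidableEq G] (S : Finset G) (v v' : G) :
    (pathTriples S v v').card ≤ ((S ×ˢ S ×ˢ S ×ˢ S).filter
      fun q => q.1 + (q.2.1 + (q.2.2.1 + q.2.2.2)) = v + v').card := by
  refine Finset.card_le_card_of_injOn
    (fun t => (v + t.1, t.2.1 + t.1, t.2.1 + t.2.2, v' + t.2.2)) ?_ ?_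
  · intro t ht
    simp only [pathTriples, Finset.coe_filter, Finset.mem_univ, true_and, Set.mem_ofPred_eq] at ht
    simp only [Finset.coe_filter, Finset.mem_product, Set.mem_ofPred_eq]
    refine ⟨ht, ?_⟩
    have e : v + t.1 + (t.2.1 + t.1 + (t.2.1 + t.2.2 + (v' + t.2.2))) =
        v + v' + ((t.1 + t.1) + (t.2.1 + t.2.1) + (t.2.2 + t.2.2)) := by abel
    rw [e]
    simp only [ZModModule.add_self, add_zero]
  · rintro ⟨x, w, y⟩ _ ⟨x', w', y'⟩ _ h
    simp only [Prod.mk.injEq, add_right_inj] at h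
    obtain ⟨rfl, h2, -, rfl⟩ := h
    rw [add_left_inj] at h2
    rw [h2]

/-- The sumset of the rich neighbours of `u` is small: each of its elements is a sum of four
elements of `S` in many ways. -/
lemma card_richNbrs_add_le [Module (ZMod 2) G] [DecidableEq G] {D : G → ℝ} (hD : IsPMF D)
    {S : Finset G} {ρ₁ ρ₂ B : ℝ} (h₁ : 0 ≤ ρ₁) (hB : ∀ x, D x ≤ B) (u : G) :
    ((richNbrs D S ρ₁ ρ₂ u + richNbrs D S ρ₁ ρ₂ u).card : ℝ) *
      ((prob D (Nbr S u) - 2 * ρ₂) * ρ₁ ^ 2) ≤ (S.card : ℝ) ^ 4 * B ^ 3 := by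
  set A := richNbrs D S ρ₁ ρ₂ u
  have hB0 : 0 ≤ B := (hD.nonneg u).trans (hB u)
  let R : G → ℕ := fun t =>
    ((S ×ˢ S ×ˢ S ×ˢ S).filter fun q => q.1 + (q.2.1 + (q.2.2.1 + q.2.2.2)) = t).card
  have hR : ∀ t ∈ A + A, (prob D (Nbr S u) - 2 * ρ₂) * ρ₁ ^ 2 ≤ R t * B ^ 3 := by
    intro t ht
    obtain ⟨v, hv, v', hv', rfl⟩ := Finset.mem_add.1 ht
    refine (card_pathTriples_ge hD h₁ hB hv hv').trans ?_
    have := card_pathTriples_le S v v'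
    have : ((pathTriples S v v').card : ℝ) ≤ R (v + v') := by exact_mod_cast this
    gcongr
  have hsum : ∑ t, R t = S.card ^ 4 := by
    rw [← Finset.card_eq_sum_card_fiberwise fun _ _ => Finset.mem_coe.2 (Finset.mem_univ _)]
    simp only [Finset.card_product]
    ring
  calc _ = ∑ t ∈ A + A, (prob D (Nbr S u) - 2 * ρ₂) * ρ₁ ^ 2 := by
        rw [Finset.sum_const, nsmul_eq_mul]
    _ ≤ ∑ t ∈ A + A, (R t : ℝ) * B ^ 3 := Finset.sum_le_sum hR
    _ ≤ ∑ t, (R t : ℝ) * B ^ 3 :=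
        Finset.sum_le_sum_of_subset_of_nonneg (Finset.subset_univ _) fun _ _ _ => by positivity
    _ = _ := by rw [← Finset.sum_mul, ← Nat.cast_sum, hsum]; push_cast; ring

end Graph

/-! ### Degrees in a dense graph -/

section Degree

variable {G : Type*} [AddCommGroup G]

open Classical in
/-- The number of neighbours of `x` in the Cayley sum graph of `S`. -/
noncomputable def deg (S : Finset G) (x : G) : ℕ := (S.filter fun a => x + a ∈ S).card

open Classical in
lemma deg_eq_sum (S : Finset G) (x : G) :
    (deg S x : ℝ) = ∑ a ∈ S, if x + a ∈ S then 1 else 0 := by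
  rw [deg, Finset.card_filter]; push_cast; rfl

open Classical in
/-- Walks of length three in a graph with `E` ordered edges on `N` vertices: the vertices of degree
below `t = E / (4 N)` meet at most half of the edges, and each other edge is the middle of at least
`t²` walks. -/
lemma sum_deg_mul_deg_ge {S : Finset G} {d : ℝ} (hd : 0 ≤ d)
    (hE : d * (S.card : ℝ) ^ 2 ≤ ∑ x ∈ S, (deg S x : ℝ)) :
    d ^ 3 * (S.card : ℝ) ^ 4 / 32 ≤
      ∑ x ∈ S, ∑ y ∈ S, if x + y ∈ S then (deg S x : ℝ) * deg S y else 0 := by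
  set N : ℝ := (S.card : ℝ)
  set E : ℝ := ∑ x ∈ S, (deg S x : ℝ)
  set t : ℝ := d * N / 4
  have hN : 0 ≤ N := Nat.cast_nonneg _
  have ht : 0 ≤ t := by positivity
  let l : G → ℝ := fun x => if (deg S x : ℝ) < t then 1 else 0
  have hlow : ∑ x ∈ S, l x * deg S x ≤ N * t := by
    calc ∑ x ∈ S, l x * deg S x ≤ ∑ x ∈ S, t := by
          refine Finset.sum_le_sum fun x _ => ?_
          simp only [l]
          split_ifs with h
          · rw [one_mul]; exact h.le
          · simpa using ht
      _ = N * t := by rw [Finset.sum_const, nsmul_eq_mul]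
  have hpt : ∀ x y, t ^ 2 * (1 - l x - l y) ≤ (deg S x : ℝ) * deg S y := by
    intro x y
    have hx : (0 : ℝ) ≤ deg S x := Nat.cast_nonneg _
    have hy : (0 : ℝ) ≤ deg S y := Nat.cast_nonneg _
    have hxy : 0 ≤ (deg S x : ℝ) * deg S y := mul_nonneg hx hy
    have ht2 := sq_nonneg t
    simp only [l]
    split_ifs with h h' h'
    · nlinarith
    · nlinarith
    · nlinarith
    · nlinarith [not_lt.1 h, not_lt.1 h']
  have h1 : ∑ x ∈ S, ∑ y ∈ S, (if x + y ∈ S then l x else 0) = ∑ x ∈ S, l x * deg S x := by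
    refine Finset.sum_congr rfl fun x _ => ?_
    rw [deg_eq_sum, Finset.mul_sum]
    simp
  have h2 : ∑ x ∈ S, ∑ y ∈ S, (if x + y ∈ S then l y else 0) = ∑ x ∈ S, l x * deg S x := by
    rw [Finset.sum_comm, ← h1]
    simp only [add_comm]
  have h3 : ∑ x ∈ S, ∑ y ∈ S, (if x + y ∈ S then (1 : ℝ) else 0) = E := by
    simp only [E, deg_eq_sum]
  have hsum : t ^ 2 * (E - 2 * (N * t)) ≤
      ∑ x ∈ S, ∑ y ∈ S, if x + y ∈ S then (deg S x : ℝ) * deg S y else 0 := by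
    calc t ^ 2 * (E - 2 * (N * t))
        ≤ t ^ 2 * (E - ∑ x ∈ S, l x * deg S x - ∑ x ∈ S, l x * deg S x) :=
          mul_le_mul_of_nonneg_left (by linarith) (sq_nonneg t)
      _ = ∑ x ∈ S, ∑ y ∈ S, if x + y ∈ S then t ^ 2 * (1 - l x - l y) else 0 := by
          nth_rewrite 2 [← h2]
          rw [← h1, ← h3]
          simp only [← Finset.sum_sub_distrib, Finset.mul_sum]
          refine Finset.sum_congr rfl fun x _ => Finset.sum_congr rfl fun y _ => ?_
          split_ifs <;> ring
      _ ≤ _ := by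
          refine Finset.sum_le_sum fun x _ => Finset.sum_le_sum fun y _ => ?_
          split_ifs
          exacts [hpt x y, le_rfl]
  refine le_trans ?_ hsum
  have : d * N ^ 2 / 2 ≤ E - 2 * (N * t) := by
    have : N * t = d * N ^ 2 / 4 := by simp only [t]; ring
    linarith
  calc d ^ 3 * N ^ 4 / 32 = t ^ 2 * (d * N ^ 2 / 2) := by simp only [t]; ring
    _ ≤ _ := mul_le_mul_of_nonneg_left this (sq_nonneg t)

open Classical in
lemma sq_mul_sum_deg_mul_deg_le [Fintype G] {D : G → ℝ} (hD : IsPMF D) {S : Finset G} {κ : ℝ}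
    (hκ : 0 ≤ κ) (h : ∀ x ∈ S, κ * deg S x ≤ D x) :
    κ ^ 2 * ∑ x ∈ S, ∑ y ∈ S, (if x + y ∈ S then (deg S x : ℝ) * deg S y else 0) ≤
      ∑ u, D u * prob D (Nbr S u) := by
  rw [Finset.mul_sum]
  calc _ ≤ ∑ x ∈ S, D x * prob D (Nbr S x) := by
        refine Finset.sum_le_sum fun x hx => ?_
        rw [prob, Finset.mul_sum, Finset.mul_sum]
        calc _ ≤ ∑ y ∈ S, D x * (if Nbr S x y then D y else 0) := by
              refine Finset.sum_le_sum fun y hy => ?_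
              by_cases hxy : x + y ∈ S
              · rw [if_pos hxy, if_pos ⟨hy, hxy⟩]
                calc κ ^ 2 * ((deg S x : ℝ) * deg S y) = (κ * deg S x) * (κ * deg S y) := by ring
                  _ ≤ _ := mul_le_mul (h x hx) (h y hy) (by positivity) (hD.nonneg x)
              · rw [if_neg hxy, if_neg fun h' => hxy h'.2, mul_zero, mul_zero]
          _ ≤ _ := Finset.sum_le_sum_of_subset_of_nonneg (Finset.subset_univ S) fun y _ _ => by
              have := hD.nonneg x
              have := hD.nonneg y
              split_ifs <;> positivity
    _ ≤ _ := Finset.sum_le_sum_of_subset_of_nonneg (Finset.subset_univ S) fun y _ _ =>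
        mul_nonneg (hD.nonneg y) (prob_nonneg hD.nonneg _)

end Degree

/-! ### The sampling distribution on a good set -/

section GoodSet

variable {n : ℕ} {ψ : Bits n → ℂ} {γ : ℝ} {S : Finset (Vec n)}

lemma le_one_of_le_mean (hψ : IsState ψ) (h : γ ≤ ∑ x, weylDist ψ x * weight ψ x) : γ ≤ 1 := by
  refine h.trans ?_
  rw [← sum_weylDist hψ]
  exact Finset.sum_le_sum fun x _ =>
    mul_le_of_le_one_right (weylDist_nonneg ψ x) (weight_le_one hψ x)

lemma IsGoodSet.weight_ge (hS : IsGoodSet ψ γ S) {x : Vec n} (hx : x ∈ S) :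
    γ / 4 ≤ weight ψ x := by
  have := hS.subset_level hx
  simpa [levelSet] using this

lemma IsGoodSet.card_pos (hS : IsGoodSet ψ γ S) (hγ : 0 < γ) : (0 : ℝ) < S.card :=
  lt_of_lt_of_le (by positivity) hS.card_ge

lemma IsGoodSet.sum_deg_ge (hS : IsGoodSet ψ γ S) (hγ : 0 < γ) :
    γ ^ 5 / 20 * (S.card : ℝ) ^ 2 ≤ ∑ x ∈ S, (deg S x : ℝ) := by
  classical
  have h := hS.density_ge
  have hc := hS.card_pos hγ
  rw [additiveDensity, le_div_iff₀ (by positivity)] at h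
  refine h.trans (le_of_eq ?_)
  rw [Finset.card_filter, Finset.sum_product]
  push_cast
  refine Finset.sum_congr rfl fun x _ => ?_
  rw [deg_eq_sum]
  exact Finset.sum_congr rfl fun a _ => by congr

lemma IsGoodSet.weylDist_ge (hS : IsGoodSet ψ γ S) (hγ : 0 < γ) (x : Vec n) :
    (γ / 4 / 2 ^ n) ^ 2 * deg S x ≤ weylDist ψ x := by
  classical
  have hp : ∀ y ∈ S, γ / 4 / 2 ^ n ≤ charDist ψ y := fun y hy => by
    rw [charDist_eq]
    have := hS.weight_ge hy
    gcongr
  rw [deg_eq_sum, Finset.mul_sum]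
  calc _ ≤ ∑ y ∈ S, charDist ψ y * charDist ψ (x + y) := by
        refine Finset.sum_le_sum fun y hy => ?_
        have h1 := charDist_nonneg ψ y
        have h2 := charDist_nonneg ψ (x + y)
        split_ifs with h
        · rw [mul_one, sq]
          exact mul_le_mul (hp y hy) (hp _ h) (by positivity) h1
        · rw [mul_zero]; positivity
    _ ≤ _ := Finset.sum_le_sum_of_subset_of_nonneg (Finset.subset_univ S) fun y _ _ =>
        mul_nonneg (charDist_nonneg _ _) (charDist_nonneg _ _)

lemma IsGoodSet.sum_weylDist_mul_weight_ge (hS : IsGoodSet ψ γ S) (hγ : 0 < γ) :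
    (γ / 4) ^ 3 * (γ ^ 5 / 20) * ((S.card : ℝ) / 2 ^ n) ^ 2 ≤
      ∑ y ∈ S, weylDist ψ y * weight ψ y := by
  calc (γ / 4) ^ 3 * (γ ^ 5 / 20) * ((S.card : ℝ) / 2 ^ n) ^ 2
      = (γ / 4) * (γ / 4 / 2 ^ n) ^ 2 * (γ ^ 5 / 20 * (S.card : ℝ) ^ 2) := by
        field_simp
    _ ≤ (γ / 4) * (γ / 4 / 2 ^ n) ^ 2 * ∑ x ∈ S, (deg S x : ℝ) :=
        mul_le_mul_of_nonneg_left (hS.sum_deg_ge hγ) (by positivity)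
    _ = ∑ x ∈ S, (γ / 4 / 2 ^ n) ^ 2 * deg S x * (γ / 4) := by
        rw [Finset.mul_sum]; exact Finset.sum_congr rfl fun x _ => by ring
    _ ≤ _ := Finset.sum_le_sum fun x hx =>
        mul_le_mul (hS.weylDist_ge hγ x) (hS.weight_ge hx) (by positivity) (weylDist_nonneg _ _)

lemma IsGoodSet.sum_weylDist_mul_weight_pos (hS : IsGoodSet ψ γ S) (hγ : 0 < γ) :
    0 < ∑ y ∈ S, weylDist ψ y * weight ψ y := by
  have := hS.card_pos hγ
  exact lt_of_lt_of_le (by positivity) (hS.sum_weylDist_mul_weight_ge hγ)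

lemma sum_weylDist_mul_weight_le_one (hψ : IsState ψ) (S : Finset (Vec n)) :
    ∑ y ∈ S, weylDist ψ y * weight ψ y ≤ 1 := by
  rw [← sum_weylDist hψ]
  calc _ ≤ ∑ y ∈ S, weylDist ψ y := Finset.sum_le_sum fun x _ =>
        mul_le_of_le_one_right (weylDist_nonneg ψ x) (weight_le_one hψ x)
    _ ≤ _ := Finset.sum_le_sum_of_subset_of_nonneg (Finset.subset_univ S) fun y _ _ =>
        weylDist_nonneg _ _

lemma sampleDist_of_notMem {x : Vec n} (hx : x ∉ S) : sampleDist ψ S x = 0 := by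
  simp [sampleDist, hx]

lemma sampleDist_of_mem {x : Vec n} (hx : x ∈ S) : sampleDist ψ S x =
    weylDist ψ x * weight ψ x / ∑ y ∈ S, weylDist ψ y * weight ψ y := by
  simp [sampleDist, hx]

lemma IsGoodSet.isPMF_sampleDist (hS : IsGoodSet ψ γ S) (hγ : 0 < γ) :
    IsPMF (sampleDist ψ S) where
  nonneg x := by
    by_cases hx : x ∈ S
    · rw [sampleDist_of_mem hx]
      exact div_nonneg (mul_nonneg (weylDist_nonneg ψ x) (weight_nonneg ψ x))
        (hS.sum_weylDist_mul_weight_pos hγ).le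
    · rw [sampleDist_of_notMem hx]
  sum_eq := by
    rw [← Finset.sum_subset (Finset.subset_univ S) fun x _ hx => sampleDist_of_notMem hx,
      Finset.sum_congr rfl fun x hx => sampleDist_of_mem hx, ← Finset.sum_div,
      div_self (hS.sum_weylDist_mul_weight_pos hγ).ne']

/-- The samples are spread out: no point of `S` is much more likely than under the uniform
distribution on `S`. -/
lemma IsGoodSet.sampleDist_le (hS : IsGoodSet ψ γ S) (hψ : IsState ψ) (hγ : 0 < γ) (x : Vec n) :
    sampleDist ψ S x ≤ C₁ / γ ^ 10 / S.card := by
  have hN := hS.card_pos hγ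
  by_cases hx : x ∈ S
  · have hZ := hS.sum_weylDist_mul_weight_pos hγ
    have hZ' := hS.sum_weylDist_mul_weight_ge hγ
    have hc := hS.card_ge
    rw [sampleDist_of_mem hx, div_le_iff₀ hZ]
    set v : ℝ := 2 ^ n
    set N : ℝ := (S.card : ℝ)
    have hv : 0 < v := by positivity
    calc weylDist ψ x * weight ψ x ≤ 1 / v * 1 :=
          mul_le_mul (weylDist_le hψ x) (weight_le_one hψ x) (weight_nonneg _ _) (by positivity)
      -- One of the two factors `|S| / 2ⁿ` is bounded below by `γ² / 80`; `C₁ = 80 · 4³ · 20`.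
      _ ≤ C₁ / γ ^ 10 / N * ((γ / 4) ^ 3 * (γ ^ 5 / 20) * (N / v) ^ 2) := by
          have e : C₁ / γ ^ 10 / N * ((γ / 4) ^ 3 * (γ ^ 5 / 20) * (N / v) ^ 2) =
              80 * N / (γ ^ 2 * v ^ 2) := by
            rw [C₁]; field_simp; norm_num
          rw [e, mul_one, div_le_div_iff₀ hv (by positivity)]
          nlinarith
      _ ≤ _ := mul_le_mul_of_nonneg_left hZ' (by rw [C₁]; positivity)
  · rw [sampleDist_of_notMem hx, C₁]
    positivity

lemma IsGoodSet.sampleDist_ge (hS : IsGoodSet ψ γ S) (hψ : IsState ψ) (hγ : 0 < γ) {x : Vec n}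
    (hx : x ∈ S) : (γ / 4) ^ 3 / (2 ^ n) ^ 2 * deg S x ≤ sampleDist ψ S x := by
  rw [sampleDist_of_mem hx, le_div_iff₀ (hS.sum_weylDist_mul_weight_pos hγ)]
  calc (γ / 4) ^ 3 / (2 ^ n) ^ 2 * deg S x * ∑ y ∈ S, weylDist ψ y * weight ψ y
      ≤ (γ / 4) ^ 3 / (2 ^ n) ^ 2 * deg S x * 1 :=
        mul_le_mul_of_nonneg_left (sum_weylDist_mul_weight_le_one hψ S) (by positivity)
    _ = (γ / 4 / 2 ^ n) ^ 2 * deg S x * (γ / 4) := by field_simp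
    _ ≤ _ := mul_le_mul (hS.weylDist_ge hγ x) (hS.weight_ge hx) (by positivity)
        (weylDist_nonneg _ _)

/-- Two independent samples are adjacent with probability polynomial in `γ`. -/
lemma IsGoodSet.mean_prob_nbr_ge (hS : IsGoodSet ψ γ S) (hψ : IsState ψ) (hγ : 0 < γ)
    (hγ1 : γ ≤ 1) :
    γ ^ 64 / C₂ ≤ ∑ u, sampleDist ψ S u * prob (sampleDist ψ S) (Nbr S u) := by
  have hD := hS.isPMF_sampleDist hγ
  have hN := hS.card_pos hγ
  set κ : ℝ := (γ / 4) ^ 3 / (2 ^ n) ^ 2 with hκ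
  have hκ0 : 0 ≤ κ := by positivity
  have hpath := sum_deg_mul_deg_ge (by positivity) (hS.sum_deg_ge hγ)
  have hlow := sq_mul_sum_deg_mul_deg_le hD hκ0 fun x hx => hS.sampleDist_ge hψ hγ hx
  have hfrac : γ ^ 2 / 80 ≤ S.card / 2 ^ n := by
    rw [le_div_iff₀ (by positivity)]; exact hS.card_ge
  refine le_trans ?_ ((mul_le_mul_of_nonneg_left hpath (sq_nonneg κ)).trans hlow)
  calc γ ^ 64 / C₂ ≤ γ ^ 29 / (2 ^ 32 * 10 ^ 7) := by
        have : γ ^ 64 ≤ γ ^ 29 := pow_le_pow_of_le_one hγ.le hγ1 (by norm_num)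
        rw [C₂]
        gcongr <;> norm_num
    _ = (γ / 4) ^ 6 * (γ ^ 5 / 20) ^ 3 * (γ ^ 2 / 80) ^ 4 / 32 := by field_simp; norm_num
    _ ≤ (γ / 4) ^ 6 * (γ ^ 5 / 20) ^ 3 * (S.card / 2 ^ n) ^ 4 / 32 := by gcongr
    _ = _ := by rw [hκ]; field_simp

end GoodSet

/-! ### The sets attached to a vertex -/

section Vertex

variable {n : ℕ} {ψ : Bits n → ℂ} {γ : ℝ} {S : Finset (Vec n)}

lemma prSample_eq (E : Vec n → Prop) : prSample ψ S E = prob (sampleDist ψ S) E := rfl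

lemma IsGoodSet.mem_nbhd_iff (hS : IsGoodSet ψ γ S) {ζ : ℝ} (hζ : ζ ≤ γ / 4) {u v : Vec n}
    (hu : u ∈ S) : v ∈ nbhd ψ S ζ u ↔ Nbr S u v := by
  classical
  simp only [nbhd, Finset.mem_filter]
  exact ⟨fun h => ⟨h.1, h.2.1⟩, fun h => ⟨h.1, h.2, hζ.trans (hS.weight_ge hu),
    hζ.trans (hS.weight_ge h.1), hζ.trans (hS.weight_ge h.2)⟩⟩

/-- Every point of `S` has weight at least `γ / 4`, so smaller thresholds do not affect the sets
`T`. -/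
lemma IsGoodSet.setT_eq (hS : IsGoodSet ψ γ S) {ζ₁ ζ₂ ζ₃ : ℝ} (h₁ : ζ₁ ≤ γ / 4)
    (h₂ : ζ₂ ≤ γ / 4) (h₃ : ζ₃ ≤ γ / 4) (ρ₁ ρ₂ : ℝ) {u : Vec n} (hu : u ∈ S) :
    setT ψ S u ζ₁ ζ₂ ζ₃ ρ₁ ρ₂ = richNbrs (sampleDist ψ S) S ρ₁ ρ₂ u := by
  ext v
  rw [mem_richNbrs, setT, Finset.mem_filter, hS.mem_nbhd_iff h₁ hu]
  refine and_congr_right fun hv => ?_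
  rw [badMass, prSample_eq]
  rw [prob_congr fun w => ?_]
  rw [hS.mem_nbhd_iff h₂ hu]
  refine and_congr_right fun hw => ?_
  rw [codeg, prSample_eq]
  rw [prob_congr fun x => ?_]
  rw [Finset.mem_inter, hS.mem_nbhd_iff h₃ hv.1, hS.mem_nbhd_iff h₃ hw.1]

lemma rho₁_pos (hγ : 0 < γ) : 0 < rho₁ γ := by rw [rho₁, C₁, C₂]; positivity

lemma rho₂_pos (hγ : 0 < γ) : 0 < rho₂ γ := by rw [rho₂, C₁, C₂]; positivity

lemma rho₁_le_one (hγ : 0 < γ) (hγ1 : γ ≤ 1) : rho₁ γ ≤ 1 := by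
  have : γ ^ 350 ≤ 1 := pow_le_one₀ hγ.le hγ1
  rw [rho₁, C₁, C₂, div_le_one (by positivity)]
  refine this.trans (by norm_num)

lemma rho₂_le (hγ : 0 < γ) (hγ1 : γ ≤ 1) : 20 * rho₂ γ / 9 ≤ γ ^ 64 / C₂ / 8 := by
  have h : γ ^ 202 ≤ γ ^ 64 := pow_le_pow_of_le_one hγ.le hγ1 (by norm_num)
  have hC : C₂ * 8 ≤ 128 * C₁ * C₂ ^ 3 := by rw [C₁, C₂]; norm_num
  have hC0 : 0 < C₂ := by rw [C₂]; positivity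
  calc 20 * rho₂ γ / 9 = γ ^ 202 / (128 * C₁ * C₂ ^ 3) := by
        rw [rho₂]; ring
    _ ≤ γ ^ 64 / (C₂ * 8) := div_le_div₀ (by positivity) h (by positivity) hC
    _ = _ := by rw [div_div]

lemma rho₂_le_one (hγ : 0 < γ) (hγ1 : γ ≤ 1) : 10 * rho₂ γ / 9 ≤ 1 := by
  have h := rho₂_le hγ hγ1
  have h64 : γ ^ 64 ≤ 1 := pow_le_one₀ hγ.le hγ1
  have : γ ^ 64 / C₂ ≤ 1 := by
    rw [C₂, div_le_one (by positivity)]; exact h64.trans (by norm_num)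
  linarith

lemma rho₁_div_rho₂_le (hγ : 0 < γ) (hγ1 : γ ≤ 1) :
    rho₁ γ / rho₂ γ ≤ γ ^ 64 / C₂ / 2 := by
  have h : γ ^ 148 ≤ γ ^ 64 := pow_le_pow_of_le_one hγ.le hγ1 (by norm_num)
  have hC : C₂ * 2 ≤ 36 * C₁ ^ 2 * C₂ ^ 2 := by rw [C₁, C₂]; norm_num
  have hC0 : 0 < C₂ := by rw [C₂]; positivity
  calc rho₁ γ / rho₂ γ = γ ^ 148 / (36 * C₁ ^ 2 * C₂ ^ 2) := by
        rw [rho₁, rho₂]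
        have h1 : C₁ ≠ 0 := by rw [C₁]; positivity
        have h2 : C₂ ≠ 0 := by rw [C₂]; positivity
        field_simp
        norm_num
    _ ≤ γ ^ 64 / (C₂ * 2) := div_le_div₀ (by positivity) h (by positivity) hC
    _ = _ := by rw [div_div]

lemma numIntervals_pos (hγ : 0 < γ) : 0 < numIntervals γ := by
  rw [numIntervals, Nat.ceil_pos, rho₃, C₁, C₂]
  positivity

lemma mu_nonneg (hγ : 0 < γ) : 0 ≤ mu γ := by rw [mu]; positivity

/-- The sub-intervals lie below `γ / 18`. -/
lemma zeta_add_mu_le (hγ : 0 < γ) (j : Fin (numIntervals γ)) : zeta γ j + mu γ ≤ γ / 18 := by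
  have hN : (0 : ℝ) < numIntervals γ := by exact_mod_cast numIntervals_pos hγ
  have hj : ((j : ℕ) : ℝ) + 1 ≤ numIntervals γ := by exact_mod_cast j.2
  have h1 : numIntervals γ * mu γ = γ / 40 := by rw [mu]; field_simp; norm_num
  have h2 := mul_le_mul_of_nonneg_right hj (mu_nonneg hγ)
  rw [zeta]
  linarith

lemma IsGoodSet.setA₁_eq (hS : IsGoodSet ψ γ S) (hγ : 0 < γ) (j : Fin (numIntervals γ))
    {u : Vec n} (hu : u ∈ S) :
    setA₁ ψ S γ j u = richNbrs (sampleDist ψ S) S (rho₁ γ) (rho₂ γ) u := by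
  have h := zeta_add_mu_le hγ j
  have hm := mu_nonneg hγ
  exact hS.setT_eq (by linarith) (by linarith) (by linarith) _ _ hu

lemma IsGoodSet.setA₂_eq (hS : IsGoodSet ψ γ S) (hγ : 0 < γ) (j : Fin (numIntervals γ))
    {u : Vec n} (hu : u ∈ S) : setA₂ ψ S γ j u =
      richNbrs (sampleDist ψ S) S (10 * rho₁ γ / 11) (10 * rho₂ γ / 9) u := by
  have h := zeta_add_mu_le hγ j
  have hm := mu_nonneg hγ
  exact hS.setT_eq (by linarith) (by linarith) (by linarith) _ _ hu

end Vertex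

/-! ### Reliability of the tests -/

section Sampling

variable {α : Type*} [Fintype α]

open Classical in
/-- The indicator of a proposition. -/
noncomputable def indic (P : Prop) : ℝ := if P then 1 else 0

lemma indic_of_true {P : Prop} (h : P) : indic P = 1 := if_pos h

lemma indic_of_false {P : Prop} (h : ¬ P) : indic P = 0 := if_neg h

lemma abs_indic_le_one (P : Prop) : |indic P| ≤ 1 := by
  unfold indic; split_ifs <;> simp

lemma sum_mul_indic (p : α → ℝ) (E : α → Prop) : ∑ a, p a * indic (E a) = prob p E :=
  (prob_eq_sum_indicator p E).symm

lemma prob_imp_ge {p : α → ℝ} (hp : IsPMF p) {A : Prop} {E : α → Prop} {ε : ℝ} (hε : 0 ≤ ε)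
    (h : A → 1 - ε ≤ prob p E) : 1 - ε ≤ prob p fun a => A → E a := by
  by_cases hA : A
  · simpa [hA] using h hA
  · simp only [hA, false_imp_iff]
    rw [prob_true, hp.sum_eq]
    linarith

/-- The frequencies of two events in a sample tell reliably whether the first event is rare and
whether the second is common. -/
lemma prob_sample_ge {D : α → ℝ} (hD : IsPMF D) {S : Finset α} (hDS : ∀ x, x ∉ S → D x = 0)
    (P Q : α → Prop) {τ a b g : ℝ} (hτ : |τ| ≤ 1) (hg : 0 ≤ g) (ha : a ≤ τ - g) (hb : τ + g ≤ b)
    (N : ℕ) :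
    1 - 2 * Real.exp (-(N * (g ^ 2 / 16))) ≤
      prob (fun ω : Fin N → α => ∏ i, D (ω i)) (fun ω => (∀ i, ω i ∈ S) ∧
        (prob D P ≤ a → ∑ i, indic (P (ω i)) < N * τ) ∧
        (b < prob D Q → N * τ < ∑ i, indic (Q (ω i)))) := by
  have hpi : IsPMF (fun ω : Fin N → α => ∏ i, D (ω i)) := isPMF_pi fun _ => hD
  have hS : 1 - (0 : ℝ) ≤ prob (fun ω : Fin N → α => ∏ i, D (ω i)) (fun ω => ∀ i, ω i ∈ S) := by
    have h1 : 1 - (0 : ℝ) ≤ prob D fun x => x ∈ S := by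
      rw [sub_zero, ← hD.sum_eq, prob]
      refine Finset.sum_le_sum fun x _ => ?_
      split_ifs with h
      exacts [le_rfl, (hDS x h).le]
    have := prob_pi_ge (ι := Fin N) (p := fun _ => D) (fun _ => hD) (fun _ => h1)
    simpa using this
  have hP := prob_imp_ge hpi (Real.exp_nonneg _) fun h : prob D P ≤ a =>
    prob_sum_lt_ge hD (fun _ => abs_indic_le_one _) hτ hg
      (by rw [sum_mul_indic]; exact h.trans ha) N
  have hQ := prob_imp_ge hpi (Real.exp_nonneg _) fun h : b < prob D Q =>
    prob_lt_sum_ge hD (fun _ => abs_indic_le_one _) hτ hg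
      (by rw [sum_mul_indic]; exact hb.trans h.le) N
  have := prob_and_ge hpi hS (prob_and_ge hpi hP hQ)
  refine le_trans (le_of_eq ?_) this
  ring

/-- The chain of independent and dependent stages of a run: samples `z` and `w`, and measurements
whose laws depend on the samples. -/
lemma prob_stages_ge {Z W M X Y V : Type*} [Fintype Z] [Fintype W] [Fintype M] [Fintype X]
    [Fintype Y] [Fintype V] {pz : Z → ℝ} {pw : W → ℝ} {pm : M → ℝ} {px : Z → X → ℝ}
    {py : W → Y → ℝ} {pv : Z → W → V → ℝ} (hz : ∀ z, 0 ≤ pz z) (hw : ∀ w, 0 ≤ pw w)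
    (hm : ∀ m, 0 ≤ pm m) (hx : ∀ z x, 0 ≤ px z x) (hy : ∀ w y, 0 ≤ py w y)
    (hv : ∀ z w v, 0 ≤ pv z w v) {Ez : Z → Prop} {Ew : Z → W → Prop} {Em : M → Prop}
    {Ex : Z → X → Prop} {Ey : W → Y → Prop} {Ev : Z → W → V → Prop} {a b c d e f : ℝ}
    (ha : 0 ≤ a) (hb : 0 ≤ b) (hc : 0 ≤ c) (hd : 0 ≤ d) (he : 0 ≤ e) (hf : 0 ≤ f)
    (Hz : 1 - a ≤ prob pz Ez) (Hw : ∀ z, Ez z → 1 - b ≤ prob pw (Ew z)) (Hm : 1 - c ≤ prob pm Em)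
    (Hx : ∀ z, Ez z → 1 - d ≤ prob (px z) (Ex z))
    (Hy : ∀ z w, Ez z → Ew z w → 1 - e ≤ prob (py w) (Ey w))
    (Hv : ∀ z w, Ez z → Ew z w → 1 - f ≤ prob (pv z w) (Ev z w)) :
    1 - (a + (b + (c + (d + (e + f))))) ≤
      prob (fun ω : Z × W × M × X × Y × V => pz ω.1 * (pw ω.2.1 * (pm ω.2.2.1 *
        (px ω.1 ω.2.2.2.1 * (py ω.2.1 ω.2.2.2.2.1 * pv ω.1 ω.2.1 ω.2.2.2.2.2)))))
      (fun ω => Ez ω.1 ∧ Ew ω.1 ω.2.1 ∧ Em ω.2.2.1 ∧ Ex ω.1 ω.2.2.2.1 ∧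
        Ey ω.2.1 ω.2.2.2.2.1 ∧ Ev ω.1 ω.2.1 ω.2.2.2.2.2) := by
  have h4 := fun z w (h : Ez z) (h' : Ew z w) => prob_prod_ge (κ := fun _ => pv z w)
    (hy w) he hf (fun _ => hv z w) (Hy z w h h') (fun _ _ => Hv z w h h')
  have n4 := fun z w (t : Y × V) => mul_nonneg (hy w t.1) (hv z w t.2)
  have h3 := fun z w (h : Ez z) (h' : Ew z w) => prob_prod_ge
    (κ := fun _ (t : Y × V) => py w t.1 * pv z w t.2)
    (hx z) hd (by positivity) (fun _ => n4 z w) (Hx z h) (fun _ _ => h4 z w h h')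
  have n3 := fun z w (t : X × Y × V) => mul_nonneg (hx z t.1) (n4 z w t.2)
  have h2 := fun z w (h : Ez z) (h' : Ew z w) => prob_prod_ge
    (κ := fun _ (t : X × Y × V) => px z t.1 * (py w t.2.1 * pv z w t.2.2))
    hm hc (by positivity) (fun _ => n3 z w) Hm (fun _ _ => h3 z w h h')
  have n2 := fun z w (t : M × X × Y × V) => mul_nonneg (hm t.1) (n3 z w t.2)
  have h1 := fun z (h : Ez z) => prob_prod_ge (κ := fun w (t : M × X × Y × V) =>
      pm t.1 * (px z t.2.1 * (py w t.2.2.1 * pv z w t.2.2.2)))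
    hw hb (by positivity) (fun w => n2 z w) (Hw z h) (fun w h' => h2 z w h h')
  exact prob_prod_ge (κ := fun z (t : W × M × X × Y × V) => pw t.1 *
      (pm t.2.1 * (px z t.2.2.1 * (py t.1 t.2.2.2.1 * pv z t.1 t.2.2.2.2))))
    hz ha (by positivity) (fun z t => mul_nonneg (hw t.1) (n2 z t.1 t.2)) Hz h1

end Sampling

section Test

variable {n : ℕ} {ψ : Bits n → ℂ} {γ : ℝ} {S : Finset (Vec n)}

/-- The estimates of an edge test reach the threshold if the pair is an edge. Then the test returns
the right answer. -/
def EdgeOK {T : ℕ} (S : Finset (Vec n)) (ζ : ℝ) (x y : Vec n) (m : EdgeRun T) : Prop :=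
  x + y ∈ S → ∀ i, ζ ≤ estimate m i

open Classical in
lemma edgeTest_of_edgeOK {T : ℕ} {ζ : ℝ} {x y : Vec n} {m : EdgeRun T} (h : EdgeOK S ζ x y m) :
    edgeTest S ζ x y m = if x + y ∈ S then 1 else 0 := by
  by_cases hxy : x + y ∈ S
  · simp [edgeTest, hxy, h hxy]
  · simp [edgeTest, hxy]

lemma isPMF_edgeRunProb (hψ : IsState ψ) (T : ℕ) (x y : Vec n) :
    IsPMF (edgeRunProb (T := T) ψ x y) :=
  isPMF_pi fun i => isPMF_pi (ι := Fin T)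
    (p := fun _ => outcomeProb ψ ((![x, y, x + y] : Fin 3 → Vec n) i))
    fun _ => isPMF_outcomeProb hψ _

/-- On points of `S` the edge test is reliable: the estimated weights exceed the threshold
`γ / 18` by more than `γ / 6`, and pairs with sum outside `S` are always rejected. -/
lemma IsGoodSet.prob_edgeOK_ge (hS : IsGoodSet ψ γ S) (hψ : IsState ψ) (hγ : 0 < γ) (hγ1 : γ ≤ 1)
    {T : ℕ} (hT : 0 < T) {ζ : ℝ} (hζ : ζ ≤ γ / 18) {x y : Vec n} (hx : x ∈ S) (hy : y ∈ S) :
    1 - 3 * Real.exp (-(T * ((γ / 6) ^ 2 / 16))) ≤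
      prob (edgeRunProb (T := T) ψ x y) (EdgeOK S ζ x y) := by
  have hT' : (0 : ℝ) < T := by exact_mod_cast hT
  refine prob_imp_ge (isPMF_edgeRunProb hψ T x y) (by positivity) fun hxy => ?_
  have hpt : ∀ i, 1 - Real.exp (-(T * ((γ / 6) ^ 2 / 16))) ≤
      prob (fun m : Fin T → Bool => ∏ t, outcomeProb ψ ((![x, y, x + y] : Fin 3 → Vec n) i) (m t))
        (fun m => ζ ≤ (∑ t, eigenvalue (m t)) / T) := by
    intro i
    have hi : (![x, y, x + y] : Fin 3 → Vec n) i ∈ S := by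
      fin_cases i
      exacts [hx, hy, hxy]
    have hw := hS.weight_ge hi
    have h := prob_lt_sum_ge (isPMF_outcomeProb hψ ((![x, y, x + y] : Fin 3 → Vec n) i))
      (f := eigenvalue) (τ := γ / 18) (g := γ / 6) (fun b => by cases b <;> simp [eigenvalue])
      (by rw [abs_of_nonneg (by positivity)]; linarith) (by positivity)
      (by rw [mean_outcomeProb hψ]; linarith) T
    refine h.trans (prob_mono (isPMF_pi (ι := Fin T) fun _ => isPMF_outcomeProb hψ _).nonneg
      fun m hm => ?_)
    rw [le_div_iff₀ hT', mul_comm]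
    exact (mul_le_mul_of_nonneg_left hζ hT'.le).trans hm.le
  have := prob_pi_ge (fun i => isPMF_pi (ι := Fin T)
    (p := fun _ => outcomeProb ψ ((![x, y, x + y] : Fin 3 → Vec n) i))
    fun _ => isPMF_outcomeProb hψ _) hpt
  rw [Fintype.card_fin] at this
  exact_mod_cast this

/-- The samples `w⁽ᵏˡ⁾` for one `k` lie in `S`, and the frequency of common neighbours of `v` and
`z` among them falls on the correct side of `21 ρ₁ / 22`, the middle of the gap from `10 ρ₁ / 11` to
`ρ₁`; nothing is asked if the true probability lies in the gap. -/
def InnerOK {s : ℕ} (D : Vec n → ℝ) (S : Finset (Vec n)) (ρ₁ : ℝ) (v z : Vec n)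
    (w : Fin s → Vec n) : Prop :=
  (∀ l, w l ∈ S) ∧
    (codeg D S v z ≤ 10 * ρ₁ / 11 →
      ∑ l, indic (Nbr S v (w l) ∧ Nbr S z (w l)) < s * (21 * ρ₁ / 22)) ∧
    (ρ₁ < codeg D S v z →
      s * (21 * ρ₁ / 22) < ∑ l, indic (Nbr S v (w l) ∧ Nbr S z (w l)))

/-- The samples `z⁽ᵏ⁾` lie in `S`, and the frequency among them of neighbours of `u` with few common
neighbours with `v` falls on the correct side of `19 ρ₂ / 18`, the middle of the gap from `ρ₂` to
`10 ρ₂ / 9`. The meaning of few is `ρ₁` at the lower and `10 ρ₁ / 11` at the upper end. -/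
def OuterOK {r : ℕ} (D : Vec n → ℝ) (S : Finset (Vec n)) (ρ₁ ρ₂ : ℝ) (u v : Vec n)
    (z : Fin r → Vec n) : Prop :=
  (∀ k, z k ∈ S) ∧
    (badMass D S ρ₁ u v ≤ ρ₂ →
      ∑ k, indic (Nbr S u (z k) ∧ codeg D S v (z k) ≤ ρ₁) <
        r * (19 * ρ₂ / 18)) ∧
    (10 * ρ₂ / 9 < badMass D S (10 * ρ₁ / 11) u v → r * (19 * ρ₂ / 18) <
      ∑ k, indic (Nbr S u (z k) ∧ codeg D S v (z k) ≤ 10 * ρ₁ / 11))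

/-- If all samples and measurements are typical, the output of the test is right. -/
lemma bsgTest_correct {r s T : ℕ} (hr : 0 < r) (hs : 0 < s) {D : Vec n → ℝ} {ρ₁ ρ₂ : ℝ}
    {ζ₁ ζ₂ ζ₃ : ℝ} {u v : Vec n} (hv : v ∈ S)
    {z : Fin r → Vec n} {w : Fin r → Fin s → Vec n} {m : EdgeRun T} {mX : Fin r → EdgeRun T}
    {mY mZ : Fin r → Fin s → EdgeRun T} (hz : OuterOK D S ρ₁ ρ₂ u v z)
    (hw : ∀ k, InnerOK D S ρ₁ v (z k) (w k)) (hm : EdgeOK S ζ₁ u v m)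
    (hX : ∀ k, EdgeOK S ζ₂ u (z k) (mX k)) (hY : ∀ k l, EdgeOK S ζ₃ v (w k l) (mY k l))
    (hZ : ∀ k l, EdgeOK S ζ₃ (z k) (w k l) (mZ k l)) :
    (bsgTest S u v ζ₁ ζ₂ ζ₃ (21 * ρ₁ / 22) (19 * ρ₂ / 18) (z, w, m, mX, mY, mZ) = 1 →
      v ∈ richNbrs D S (10 * ρ₁ / 11) (10 * ρ₂ / 9) u) ∧
    (bsgTest S u v ζ₁ ζ₂ ζ₃ (21 * ρ₁ / 22) (19 * ρ₂ / 18) (z, w, m, mX, mY, mZ) = 0 →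
      v ∉ richNbrs D S ρ₁ ρ₂ u) := by
  classical
  have hr' : (0 : ℝ) < r := by exact_mod_cast hr
  have hs' : (0 : ℝ) < s := by exact_mod_cast hs
  have hYZ : ∀ k, ∑ l, ((edgeTest S ζ₃ v (w k l) (mY k l) : ℕ) : ℝ) *
      (edgeTest S ζ₃ (z k) (w k l) (mZ k l) : ℕ) =
      ∑ l, indic (Nbr S v (w k l) ∧ Nbr S (z k) (w k l)) := by
    intro k
    refine Finset.sum_congr rfl fun l _ => ?_
    have hl := (hw k).1 l
    rw [edgeTest_of_edgeOK (hY k l), edgeTest_of_edgeOK (hZ k l)]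
    by_cases h1 : v + w k l ∈ S <;> by_cases h2 : z k + w k l ∈ S <;>
      simp [indic, Nbr, hl, h1, h2]
  simp only [bsgTest, edgeTest_of_edgeOK hm, hYZ]
  by_cases huv : u + v ∈ S
  swap
  · simp only [huv, if_false, if_true]
    exact ⟨fun h => absurd h (by norm_num), fun _ h => huv (mem_richNbrs.1 h).1.2⟩
  simp only [huv, if_true, one_ne_zero, if_false, div_le_iff₀ hr', div_le_iff₀ hs']
  rw [mul_comm _ (r : ℝ), mul_comm _ (s : ℝ)]
  split_ifs with hF
  · refine ⟨fun _ => mem_richNbrs.2 ⟨⟨hv, huv⟩, ?_⟩, fun h => absurd h (by norm_num)⟩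
    by_contra hbad
    -- Every `z⁽ᵏ⁾` counted by the smaller threshold `10 ρ₁ / 11` has `X_k B_k = 1`.
    refine absurd (hz.2.2 (not_le.1 hbad))
      (not_lt.2 (le_trans (Finset.sum_le_sum fun k _ => ?_) hF))
    rw [edgeTest_of_edgeOK (hX k)]
    by_cases hk : Nbr S u (z k) ∧ codeg D S v (z k) ≤ 10 * ρ₁ / 11
    · have hl := ((hw k).2.1 hk.2).le
      rw [indic_of_true hk, if_pos hk.1.2, if_pos hl]
      norm_num
    · rw [indic_of_false hk]; positivity
  · -- Conversely `X_k B_k = 1` only for `z⁽ᵏ⁾` counted by the larger threshold `ρ₁`.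
    refine ⟨fun h => absurd h (by norm_num), fun _ hrich => hF (le_trans
      (Finset.sum_le_sum fun k _ => ?_) (hz.2.1 (mem_richNbrs.1 hrich).2).le)⟩
    rw [edgeTest_of_edgeOK (hX k)]
    by_cases hk : Nbr S u (z k) ∧ codeg D S v (z k) ≤ ρ₁
    · rw [indic_of_true hk]
      split_ifs <;> simp
    · rw [indic_of_false hk]
      by_cases huz : u + z k ∈ S
      · have hl := (hw k).2.2 (not_le.1 fun h => hk ⟨⟨hz.1 k, huz⟩, h⟩)
        rw [if_neg (not_le.2 hl)]
        simp
      · simp [huz]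

set_option synthInstance.maxHeartbeats 400000 in
set_option synthInstance.maxSize 2000 in
/-- The failure probability of the test, by a union bound over all samples and measurements. -/
lemma IsGoodSet.prBSGTest_ge (hS : IsGoodSet ψ γ S) (hψ : IsState ψ) (hγ : 0 < γ) (hγ1 : γ ≤ 1)
    {r s T : ℕ} (hr : 0 < r) (hs : 0 < s) (hT : 0 < T) {ρ₁ ρ₂ : ℝ} (h₁ : 0 ≤ ρ₁) (h₁' : ρ₁ ≤ 1)
    (h₂ : 0 ≤ ρ₂) (h₂' : 10 * ρ₂ / 9 ≤ 1) {ζ₁ ζ₂ ζ₃ : ℝ} (hζ₁ : ζ₁ ≤ γ / 18)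
    (hζ₂ : ζ₂ ≤ γ / 18) (hζ₃ : ζ₃ ≤ γ / 18) {u v : Vec n} (hu : u ∈ S) (hv : v ∈ S) :
    1 - (2 * Real.exp (-(r * ((ρ₂ / 18) ^ 2 / 16))) +
        r * (2 * Real.exp (-(s * ((ρ₁ / 22) ^ 2 / 16)))) +
        (1 + r + 2 * (r * s)) * (3 * Real.exp (-(T * ((γ / 6) ^ 2 / 16))))) ≤
      prBSGTest r s T ψ S u v ζ₁ ζ₂ ζ₃ (21 * ρ₁ / 22) (19 * ρ₂ / 18) (fun F =>
        (F = 1 → v ∈ richNbrs (sampleDist ψ S) S (10 * ρ₁ / 11) (10 * ρ₂ / 9) u) ∧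
        (F = 0 → v ∉ richNbrs (sampleDist ψ S) S ρ₁ ρ₂ u)) := by
  have hD := hS.isPMF_sampleDist hγ
  have hDS : ∀ x, x ∉ S → sampleDist ψ S x = 0 := fun x => sampleDist_of_notMem
  generalize hDdef : sampleDist ψ S = D at hD hDS ⊢
  set eO := 2 * Real.exp (-(r * ((ρ₂ / 18) ^ 2 / 16)))
  set eI := 2 * Real.exp (-(s * ((ρ₁ / 22) ^ 2 / 16)))
  set eE := 3 * Real.exp (-(T * ((γ / 6) ^ 2 / 16)))
  have heO : 0 ≤ eO := by positivity
  have heI : 0 ≤ eI := by positivity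
  have heE : 0 ≤ eE := by positivity
  have hE := fun x y => isPMF_edgeRunProb hψ T x y
  have hedge : ∀ {ζ : ℝ}, ζ ≤ γ / 18 → ∀ {x y : Vec n}, x ∈ S → y ∈ S →
      1 - eE ≤ prob (edgeRunProb (T := T) ψ x y) (EdgeOK S ζ x y) :=
    fun hζ _ _ hx hy => hS.prob_edgeOK_ge hψ hγ hγ1 hT hζ hx hy
  let pz : (Fin r → Vec n) → ℝ := fun z => ∏ k, D (z k)
  let pw : (Fin r → Fin s → Vec n) → ℝ := fun w => ∏ k, ∏ l, D (w k l)
  let pX : (Fin r → Vec n) → (Fin r → EdgeRun T) → ℝ := fun z mX =>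
    ∏ k, edgeRunProb ψ u (z k) (mX k)
  let pY : (Fin r → Fin s → Vec n) → (Fin r → Fin s → EdgeRun T) → ℝ := fun w mY =>
    ∏ k, ∏ l, edgeRunProb ψ v (w k l) (mY k l)
  let pZ : (Fin r → Vec n) → (Fin r → Fin s → Vec n) → (Fin r → Fin s → EdgeRun T) → ℝ :=
    fun z w mZ => ∏ k, ∏ l, edgeRunProb ψ (z k) (w k l) (mZ k l)
  have hpz : IsPMF pz := isPMF_pi fun _ => hD
  have hpw : IsPMF pw := isPMF_pi fun _ => isPMF_pi (ι := Fin s) fun _ => hD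
  have hpX : ∀ z, IsPMF (pX z) := fun z => isPMF_pi fun k => hE u (z k)
  have hpY : ∀ w, IsPMF (pY w) := fun w =>
    isPMF_pi fun k => isPMF_pi (ι := Fin s) fun l => hE v (w k l)
  have hpZ : ∀ z w, IsPMF (pZ z w) := fun z w =>
    isPMF_pi fun k => isPMF_pi (ι := Fin s) fun l => hE (z k) (w k l)
  have hz : 1 - eO ≤ prob pz (OuterOK D S ρ₁ ρ₂ u v) :=
    prob_sample_ge hD hDS (fun x => Nbr S u x ∧ codeg D S v x ≤ ρ₁)
      (fun x => Nbr S u x ∧ codeg D S v x ≤ 10 * ρ₁ / 11) (τ := 19 * ρ₂ / 18) (a := ρ₂)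
      (b := 10 * ρ₂ / 9) (g := ρ₂ / 18) (by rw [abs_of_nonneg (by positivity)]; linarith)
      (by positivity) (by linarith) (by linarith) r
  have hw : ∀ z : Fin r → Vec n,
      1 - r * eI ≤ prob pw (fun w => ∀ k, InnerOK D S ρ₁ v (z k) (w k)) := by
    intro z
    have h : ∀ k, 1 - eI ≤ prob (fun w : Fin s → Vec n => ∏ l, D (w l))
        (InnerOK D S ρ₁ v (z k)) := fun k =>
      prob_sample_ge hD hDS (fun x => Nbr S v x ∧ Nbr S (z k) x)
        (fun x => Nbr S v x ∧ Nbr S (z k) x) (τ := 21 * ρ₁ / 22) (a := 10 * ρ₁ / 11)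
        (b := ρ₁) (g := ρ₁ / 22) (by rw [abs_of_nonneg (by positivity)]; linarith)
        (by positivity) (by linarith) (by linarith) s
    have := prob_pi_ge (ι := Fin r) (fun _ => isPMF_pi (ι := Fin s) fun _ => hD) h
    rwa [Fintype.card_fin] at this
  have hM : 1 - eE ≤ prob (edgeRunProb (T := T) ψ u v) (EdgeOK S ζ₁ u v) := hedge hζ₁ hu hv
  have hX : ∀ z : Fin r → Vec n, (∀ k, z k ∈ S) →
      1 - r * eE ≤ prob (pX z) (fun mX => ∀ k, EdgeOK S ζ₂ u (z k) (mX k)) := by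
    intro z hzS
    have := prob_pi_ge (ι := Fin r) (fun k => hE u (z k)) fun k => hedge hζ₂ hu (hzS k)
    rwa [Fintype.card_fin] at this
  have hrs : ∀ (x : Fin r → Vec n) (w : Fin r → Fin s → Vec n), (∀ k, x k ∈ S) →
      (∀ k l, w k l ∈ S) → 1 - r * (s * eE) ≤ prob (pZ x w)
        (fun m => ∀ k l, EdgeOK S ζ₃ (x k) (w k l) (m k l)) := by
    intro x w hx hwS
    have h : ∀ k, 1 - s * eE ≤ prob (fun m : Fin s → EdgeRun T => ∏ l, edgeRunProb ψ (x k) (w k l)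
        (m l)) (fun m => ∀ l, EdgeOK S ζ₃ (x k) (w k l) (m l)) := by
      intro k
      have := prob_pi_ge (ι := Fin s) (fun l => hE (x k) (w k l))
        fun l => hedge hζ₃ (hx k) (hwS k l)
      rwa [Fintype.card_fin] at this
    have := prob_pi_ge (ι := Fin r) (fun k => isPMF_pi (ι := Fin s) fun l => hE (x k) (w k l)) h
    rwa [Fintype.card_fin] at this
  have h0 := prob_stages_ge hpz.nonneg hpw.nonneg (hE u v).nonneg (fun z => (hpX z).nonneg)
    (fun w => (hpY w).nonneg) (fun z w => (hpZ z w).nonneg) heO (by positivity) heE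
    (by positivity) (by positivity) (by positivity) hz (fun z _ => hw z) hM
    (fun z h => hX z h.1) (fun z w _ h => hrs (fun _ => v) w (fun _ => hv) fun k => (h k).1)
    (fun z w h h' => hrs z w h.1 fun k => (h' k).1)
  have hprod : (fun ω : BSGRun n r s T => pz ω.1 * (pw ω.2.1 * (edgeRunProb ψ u v ω.2.2.1 *
      (pX ω.1 ω.2.2.2.1 * (pY ω.2.1 ω.2.2.2.2.1 * pZ ω.1 ω.2.1 ω.2.2.2.2.2))))) =
      bsgRunProb ψ S u v := by
    funext ⟨z, w, m, mX, mY, mZ⟩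
    simp only [bsgRunProb, hDdef, pz, pw, pX, pY, pZ, mul_assoc]
  have hnn : ∀ ω : BSGRun n r s T, 0 ≤ bsgRunProb ψ S u v ω := by
    rw [← hprod]
    exact fun ω => mul_nonneg (hpz.nonneg _) (mul_nonneg (hpw.nonneg _)
      (mul_nonneg ((hE u v).nonneg _) (mul_nonneg ((hpX _).nonneg _)
        (mul_nonneg ((hpY _).nonneg _) ((hpZ _ _).nonneg _)))))
  rw [hprod] at h0
  refine le_trans (le_of_eq ?_) (h0.trans (prob_mono hnn ?_))
  · ring
  · rintro ⟨z, w, m, mX, mY, mZ⟩ ⟨g1, g2, g3, g4, g5, g6⟩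
    exact bsgTest_correct hr hs hv g1 g2 g3 g4 g5 g6

end Test

/-! ### Sample sizes -/

section SampleSize

/-- A quantity depending on `γ` and `δ` is bounded by a polynomial in `1 / γ` and
`1 + log (1 / δ)`. -/
def PolyBounded (f : ℝ → ℝ → ℝ) : Prop :=
  ∃ K : ℕ, ∀ γ δ : ℝ, 0 < γ → γ ≤ 1 → 0 < δ → δ < 1 →
    f γ δ ≤ K * (1 / γ) ^ K * (1 + Real.log (1 / δ)) ^ K

lemma one_le_one_add_log {δ : ℝ} (hδ : 0 < δ) (hδ1 : δ < 1) : 1 ≤ 1 + Real.log (1 / δ) := by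
  have := Real.log_nonneg ((one_le_div hδ).2 hδ1.le)
  linarith

lemma one_le_inv_of_le_one {γ : ℝ} (hγ : 0 < γ) (hγ1 : γ ≤ 1) : 1 ≤ 1 / γ := (one_le_div hγ).2 hγ1

lemma polyBounded_of_le_mul {f : ℝ → ℝ → ℝ} (M k l : ℕ) (h : ∀ γ δ : ℝ, 0 < γ → γ ≤ 1 → 0 < δ →
    δ < 1 → f γ δ ≤ M * (1 / γ) ^ k * (1 + Real.log (1 / δ)) ^ l) : PolyBounded f := by
  refine ⟨M + k + l, fun γ δ hγ hγ1 hδ hδ1 => (h γ δ hγ hγ1 hδ hδ1).trans ?_⟩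
  have h1 := one_le_inv_of_le_one hγ hγ1
  have h2 := one_le_one_add_log hδ hδ1
  have hM : (M : ℝ) ≤ ((M + k + l : ℕ) : ℝ) := by exact_mod_cast by omega
  gcongr <;> first | assumption | omega

lemma PolyBounded.exists_le {f : ℝ → ℝ → ℝ} (hf : PolyBounded f) :
    ∃ K₀ : ℕ, ∀ K : ℕ, K₀ ≤ K → ∀ γ δ : ℝ, 0 < γ → γ ≤ 1 → 0 < δ → δ < 1 →
      f γ δ ≤ K * (1 / γ) ^ K * (1 + Real.log (1 / δ)) ^ K := by
  obtain ⟨K₀, h⟩ := hf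
  refine ⟨K₀, fun K hK γ δ hγ hγ1 hδ hδ1 => (h γ δ hγ hγ1 hδ hδ1).trans ?_⟩
  have h1 := one_le_inv_of_le_one hγ hγ1
  have h2 := one_le_one_add_log hδ hδ1
  gcongr

lemma PolyBounded.add {f g : ℝ → ℝ → ℝ} (hf : PolyBounded f) (hg : PolyBounded g) :
    PolyBounded fun γ δ => f γ δ + g γ δ := by
  obtain ⟨K, hK⟩ := hf.exists_le
  obtain ⟨L, hL⟩ := hg.exists_le
  refine polyBounded_of_le_mul (2 * max K L) (max K L) (max K L) fun γ δ hγ hγ1 hδ hδ1 => ?_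
  have h1 := hK _ (le_max_left K L) γ δ hγ hγ1 hδ hδ1
  have h2 := hL _ (le_max_right K L) γ δ hγ hγ1 hδ hδ1
  push_cast at h1 h2 ⊢
  linarith

lemma PolyBounded.mul {f g : ℝ → ℝ → ℝ} (hf : PolyBounded f) (hg : PolyBounded g)
    (hg0 : ∀ γ δ : ℝ, 0 < γ → γ ≤ 1 → 0 < δ → δ < 1 → 0 ≤ g γ δ) :
    PolyBounded fun γ δ => f γ δ * g γ δ := by
  obtain ⟨K, hK⟩ := hf
  obtain ⟨L, hL⟩ := hg
  refine polyBounded_of_le_mul (K * L) (K + L) (K + L) fun γ δ hγ hγ1 hδ hδ1 => ?_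
  have h2 := one_le_one_add_log hδ hδ1
  refine (mul_le_mul (hK γ δ hγ hγ1 hδ hδ1) (hL γ δ hγ hγ1 hδ hδ1) (hg0 γ δ hγ hγ1 hδ hδ1)
    (by positivity)).trans (le_of_eq ?_)
  push_cast
  ring

lemma polyBounded_const (a : ℝ) : PolyBounded fun _ _ => a := by
  obtain ⟨M, hM⟩ := exists_nat_ge a
  exact polyBounded_of_le_mul M 0 0 fun _ _ _ _ _ _ => by simpa using hM

lemma polyBounded_inv_pow (k : ℕ) : PolyBounded fun γ _ => (1 / γ) ^ k :=
  polyBounded_of_le_mul 1 k 0 fun _ _ _ _ _ _ => by simp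

lemma polyBounded_log : PolyBounded fun _ δ => Real.log (1 / δ) :=
  polyBounded_of_le_mul 1 0 1 fun _ _ _ _ _ _ => by simp

/-- A number of samples for which the failure probability `exp (-N a)` is at most `δ / x`. -/
noncomputable def sampleSize (a x δ : ℝ) : ℕ := ⌈(Real.log (1 / δ) + x) / a⌉₊

lemma sampleSize_pos {a x δ : ℝ} (ha : 0 < a) (hx : 0 < x) (hδ : 0 < δ) (hδ1 : δ < 1) :
    0 < sampleSize a x δ := by
  have := one_le_one_add_log hδ hδ1
  exact Nat.ceil_pos.2 (div_pos (by linarith) ha)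

lemma exp_neg_sampleSize_le {a x δ : ℝ} (ha : 0 < a) (hx : 0 < x) (hδ : 0 < δ) :
    Real.exp (-(sampleSize a x δ * a)) ≤ δ / x := by
  have h : Real.log (1 / δ) + x ≤ sampleSize a x δ * a := (div_le_iff₀ ha).1 (Nat.le_ceil _)
  have hx' : x ≤ Real.exp x := by linarith [Real.add_one_le_exp x]
  calc Real.exp (-(sampleSize a x δ * a)) ≤ Real.exp (-(Real.log (1 / δ) + x)) :=
        Real.exp_le_exp.2 (neg_le_neg h)
    _ = δ / Real.exp x := by
        rw [neg_add, Real.exp_add, one_div, Real.log_inv, neg_neg, Real.exp_log hδ, Real.exp_neg]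
        rfl
    _ ≤ δ / x := by gcongr

lemma polyBounded_sampleSize {a : ℝ → ℝ} {x : ℝ → ℝ → ℝ} (c : ℝ) (hc : 0 < c) (k : ℕ)
    (ha : ∀ γ, a γ = γ ^ k / c) (hx : PolyBounded x)
    (hx0 : ∀ γ δ : ℝ, 0 < γ → γ ≤ 1 → 0 < δ → δ < 1 → 0 ≤ x γ δ) :
    PolyBounded fun γ δ => (sampleSize (a γ) (x γ δ) δ : ℝ) := by
  have hc' : ∀ γ δ : ℝ, 0 < γ → γ ≤ 1 → 0 < δ → δ < 1 → 0 ≤ c * (1 / γ) ^ k :=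
    fun γ δ hγ _ _ _ => by positivity
  have h := (((polyBounded_log.add hx).mul (((polyBounded_const c).mul (polyBounded_inv_pow k)
    (fun γ δ hγ _ _ _ => by positivity))) hc').add (polyBounded_const 1))
  obtain ⟨K, hK⟩ := h
  refine ⟨K, fun γ δ hγ hγ1 hδ hδ1 => le_trans ?_ (hK γ δ hγ hγ1 hδ hδ1)⟩
  have h1 := one_le_one_add_log hδ hδ1
  have h2 := hx0 γ δ hγ hγ1 hδ hδ1
  have h3 : (Real.log (1 / δ) + x γ δ) / a γ =
      (Real.log (1 / δ) + x γ δ) * (c * (1 / γ) ^ k) := by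
    rw [ha, one_div_pow]; field_simp
  change ((⌈(Real.log (1 / δ) + x γ δ) / a γ⌉₊ : ℕ) : ℝ) ≤ _
  rw [h3]
  exact (Nat.ceil_lt_add_one (mul_nonneg (by linarith) (hc' γ δ hγ hγ1 hδ hδ1))).le

/-- The number `r` of samples `z`. -/
noncomputable def sizeR (γ δ : ℝ) : ℕ := sampleSize ((rho₂ γ / 18) ^ 2 / 16) 6 δ

/-- The number `s` of samples `w` for each `z`. -/
noncomputable def sizeS (γ δ : ℝ) : ℕ := sampleSize ((rho₁ γ / 22) ^ 2 / 16) (6 * sizeR γ δ) δ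

/-- The number `m` of measurements for each point of an edge test. -/
noncomputable def sizeT (γ δ : ℝ) : ℕ := sampleSize ((γ / 6) ^ 2 / 16)
  (9 * (1 + sizeR γ δ + 2 * (sizeR γ δ * sizeS γ δ))) δ

lemma polyBounded_sizeR : PolyBounded fun γ δ => (sizeR γ δ : ℝ) := by
  refine polyBounded_sampleSize ((2560 * C₁ * C₂ ^ 3 / 9 * 18) ^ 2 * 16) ?_ 404 (fun γ => ?_)
    (polyBounded_const 6) fun _ _ _ _ _ _ => by norm_num
  · rw [C₁, C₂]; positivity
  · rw [rho₂]
    ring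

lemma polyBounded_sizeS : PolyBounded fun γ δ => (sizeS γ δ : ℝ) := by
  refine polyBounded_sampleSize ((10240 * C₁ ^ 3 * C₂ ^ 5 * 22) ^ 2 * 16) ?_ 700 (fun γ => ?_)
    ((polyBounded_const 6).mul polyBounded_sizeR fun _ _ _ _ _ _ => by positivity)
    fun _ _ _ _ _ _ => by positivity
  · rw [C₁, C₂]; positivity
  · rw [rho₁]
    ring

lemma polyBounded_sizeT : PolyBounded fun γ δ => (sizeT γ δ : ℝ) := by
  -- `576 = 36 · 16` inverts the Chernoff exponent `(γ / 6)² / 16`.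
  refine polyBounded_sampleSize 576 (by norm_num) 2 (fun γ => by ring)
    ((polyBounded_const 9).mul (((polyBounded_const 1).add polyBounded_sizeR).add
      ((polyBounded_const 2).mul (polyBounded_sizeR.mul polyBounded_sizeS
        fun _ _ _ _ _ _ => by positivity) fun _ _ _ _ _ _ => by positivity))
      fun _ _ _ _ _ _ => by positivity)
    fun _ _ _ _ _ _ => by positivity

end SampleSize

/-! ### The BSG test and the random vertex -/

section Conclusion

variable {n : ℕ} {ψ : Bits n → ℂ} {γ : ℝ} {S : Finset (Vec n)}

/-- With the chosen sample sizes the BSG test fails with probability at most `δ`, a third of which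
is allotted to each of the samples `z`, the samples `w`, and the measurements. -/
lemma IsGoodSet.prBSGTest_sizes_ge (hS : IsGoodSet ψ γ S) (hψ : IsState ψ) (hγ : 0 < γ)
    (hγ1 : γ ≤ 1) (j : Fin (numIntervals γ)) {u v : Vec n} (hu : u ∈ S) (hv : v ∈ S) {δ : ℝ}
    (hδ : 0 < δ) (hδ1 : δ < 1) :
    1 - δ ≤ prBSGTest (sizeR γ δ) (sizeS γ δ) (sizeT γ δ) ψ S u v
      (zeta γ j + mu γ / 2) (zeta γ j - mu γ / 2) (zeta γ j + mu γ / 2)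
      (21 * rho₁ γ / 22) (19 * rho₂ γ / 18)
      (fun F => (F = 1 → v ∈ setA₂ ψ S γ j u) ∧ (F = 0 → v ∉ setA₁ ψ S γ j u)) := by
  have hρ₁ := rho₁_pos hγ
  have hρ₂ := rho₂_pos hγ
  have hm := mu_nonneg hγ
  have hζ := zeta_add_mu_le hγ j
  have hr : 0 < sizeR γ δ := sampleSize_pos (by positivity) (by norm_num) hδ hδ1
  have hr' : (0 : ℝ) < sizeR γ δ := by exact_mod_cast hr
  have hs : 0 < sizeS γ δ := sampleSize_pos (by positivity) (by positivity) hδ hδ1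
  have hs' : (0 : ℝ) < sizeS γ δ := by exact_mod_cast hs
  have hT : 0 < sizeT γ δ := sampleSize_pos (by positivity) (by positivity) hδ hδ1
  have eR : Real.exp (-(sizeR γ δ * ((rho₂ γ / 18) ^ 2 / 16))) ≤ δ / 6 :=
    exp_neg_sampleSize_le (by positivity) (by norm_num) hδ
  have eS : Real.exp (-(sizeS γ δ * ((rho₁ γ / 22) ^ 2 / 16))) ≤ δ / (6 * sizeR γ δ) :=
    exp_neg_sampleSize_le (by positivity) (by positivity) hδ
  have eT : Real.exp (-(sizeT γ δ * ((γ / 6) ^ 2 / 16))) ≤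
      δ / (9 * (1 + sizeR γ δ + 2 * (sizeR γ δ * sizeS γ δ))) :=
    exp_neg_sampleSize_le (by positivity) (by positivity) hδ
  rw [le_div_iff₀ (by positivity)] at eR eS eT
  rw [hS.setA₁_eq hγ j hu, hS.setA₂_eq hγ j hu]
  refine le_trans ?_ (hS.prBSGTest_ge hψ hγ hγ1 hr hs hT hρ₁.le (rho₁_le_one hγ hγ1) hρ₂.le
    (rho₂_le_one hγ hγ1) (by linarith) (by linarith) (by linarith) hu hv)
  linarith

/-- The constant in the upper bound for the sumset. -/
noncomputable def sumsetConst : ℝ := 8 * C₁ ^ 3 * C₂ * (121 / 100) * (10240 * C₁ ^ 3 * C₂ ^ 5) ^ 2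

lemma C₁_pos : 0 < C₁ := by rw [C₁]; positivity

lemma C₂_pos : 0 < C₂ := by rw [C₂]; positivity

lemma sumsetConst_pos : 0 < sumsetConst := by
  have := C₁_pos
  have := C₂_pos
  rw [sumsetConst]; positivity

lemma IsGoodSet.card_richNbrs_ge (hS : IsGoodSet ψ γ S) (hψ : IsState ψ) (hγ : 0 < γ)
    {A : Finset (Vec n)} (h : γ ^ 64 / C₂ / 4 ≤ prob (sampleDist ψ S) fun v => v ∈ A) :
    1 / (4 * C₁ * C₂) * γ ^ 74 * S.card ≤ (A.card : ℝ) := by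
  have hN := hS.card_pos hγ
  have h1 := C₁_pos
  have h2 := C₂_pos
  have hle := h.trans (prob_mem_le (hS.sampleDist_le hψ hγ) A)
  calc 1 / (4 * C₁ * C₂) * γ ^ 74 * S.card
      = γ ^ 64 / C₂ / 4 * (γ ^ 10 * S.card / C₁) := by field_simp
    _ ≤ A.card * (C₁ / γ ^ 10 / S.card) * (γ ^ 10 * S.card / C₁) := by gcongr
    _ = A.card := by field_simp

/-- If `u` has many neighbours then the sumset of `A⁽²⁾(u)` is small. -/
lemma IsGoodSet.card_sumset_le (hS : IsGoodSet ψ γ S) (hψ : IsState ψ) (hγ : 0 < γ)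
    (hγ1 : γ ≤ 1) {u : Vec n} (h : γ ^ 64 / C₂ / 4 ≤ prob (sampleDist ψ S) (Nbr S u)) :
    ((richNbrs (sampleDist ψ S) S (10 * rho₁ γ / 11) (10 * rho₂ γ / 9) u +
      richNbrs (sampleDist ψ S) S (10 * rho₁ γ / 11) (10 * rho₂ γ / 9) u).card : ℝ) ≤
      sumsetConst * (γ ^ 794)⁻¹ * S.card := by
  have hN := hS.card_pos hγ
  have h1 := C₁_pos
  have h2 := C₂_pos
  have hρ₁ := rho₁_pos hγ
  have hadd := card_richNbrs_add_le (hS.isPMF_sampleDist hγ) (S := S)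
    (ρ₁ := 10 * rho₁ γ / 11) (ρ₂ := 10 * rho₂ γ / 9) (by positivity) (hS.sampleDist_le hψ hγ) u
  generalize (richNbrs (sampleDist ψ S) S (10 * rho₁ γ / 11) (10 * rho₂ γ / 9) u +
      richNbrs (sampleDist ψ S) S (10 * rho₁ γ / 11) (10 * rho₂ γ / 9) u).card = m at hadd ⊢
  have hgap : γ ^ 64 / C₂ / 8 ≤ prob (sampleDist ψ S) (Nbr S u) - 2 * (10 * rho₂ γ / 9) := by
    have := rho₂_le hγ hγ1
    linarith
  have hfac : 0 < γ ^ 64 / C₂ / 8 * (10 * rho₁ γ / 11) ^ 2 := by positivity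
  have hle : (m : ℝ) * (γ ^ 64 / C₂ / 8 * (10 * rho₁ γ / 11) ^ 2) ≤
      (S.card : ℝ) ^ 4 * (C₁ / γ ^ 10 / S.card) ^ 3 := by
    refine le_trans ?_ hadd
    gcongr
  rw [← le_div_iff₀ hfac] at hle
  refine hle.trans (le_of_eq ?_)
  rw [sumsetConst, rho₁]
  field_simp
  norm_num

/-- For every sub-interval a random vertex `u` has the required properties with probability
polynomial in `γ`. -/
lemma IsGoodSet.prSample_ge (hS : IsGoodSet ψ γ S) (hψ : IsState ψ) (hγ : 0 < γ) (hγ1 : γ ≤ 1)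
    (j : Fin (numIntervals γ)) :
    1 / (4 * C₁ * C₂) * γ ^ 64 ≤ prSample ψ S fun u =>
      1 / (4 * C₁ * C₂) * γ ^ 138 * (S.card : ℝ) ≤ ((setA₁ ψ S γ j u).card : ℝ) ∧
      ((setA₂ ψ S γ j u + setA₂ ψ S γ j u).card : ℝ) ≤
        sumsetConst * (γ ^ 932)⁻¹ * (S.card : ℝ) ∧
      1 / (4 * C₁ * C₂) * γ ^ 1070 ≤
        ((setA₁ ψ S γ j u).card : ℝ) / ((setA₂ ψ S γ j u).card : ℝ) := by
  have hN := hS.card_pos hγ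
  have h1 := C₁_pos
  have h2 := C₂_pos
  have hρ₁ := rho₁_pos hγ
  have hρ₂ := rho₂_pos hγ
  have hD := hS.isPMF_sampleDist hγ
  have hmean := mean_prob_richNbrs_ge hD (S := S) (fun x => sampleDist_of_notMem) hρ₁.le hρ₂
  have hmean' : γ ^ 64 / C₂ / 2 ≤ ∑ u, sampleDist ψ S u * prob (sampleDist ψ S)
      (fun v => v ∈ richNbrs (sampleDist ψ S) S (rho₁ γ) (rho₂ γ) u) := by
    have := hS.mean_prob_nbr_ge hψ hγ hγ1
    have := rho₁_div_rho₂_le hγ hγ1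
    linarith
  -- The rich neighbours have mean mass at least `γ⁶⁴ / (2 C₂)`, hence mass at least half of
  -- that with probability at least half of that; both sets of the sub-interval
  -- are then controlled through `u` alone.
  have hhalf := prob_half_mean_le hD (fun u => prob_le_one hD _) (by positivity) hmean'
  have hlow : 1 / (4 * C₁ * C₂) * γ ^ 64 ≤ γ ^ 64 / C₂ / 2 / 2 := by
    have : (1 : ℝ) ≤ C₁ := by rw [C₁]; norm_num
    calc 1 / (4 * C₁ * C₂) * γ ^ 64 = γ ^ 64 / C₂ / 2 / 2 / C₁ := by field_simp; norm_num
      _ ≤ _ := div_le_self (by positivity) this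
  refine hlow.trans (hhalf.trans (prob_mono_of_support hD.nonneg fun u hu hrich => ?_))
  have huS : u ∈ S := by
    by_contra h
    exact hu (sampleDist_of_notMem h)
  have hrich' : γ ^ 64 / C₂ / 4 ≤ prob (sampleDist ψ S)
      (fun v => v ∈ richNbrs (sampleDist ψ S) S (rho₁ γ) (rho₂ γ) u) := by linarith
  have hA₁ := hS.card_richNbrs_ge hψ hγ hrich'
  have hA₂ := hS.card_sumset_le hψ hγ hγ1
    (hrich'.trans (prob_mono hD.nonneg fun v hv => (mem_richNbrs.1 hv).1))
  have hsub := richNbrs_mono hD.nonneg (S := S) (ρ₁ := rho₁ γ) (ρ₁' := 10 * rho₁ γ / 11)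
    (ρ₂ := rho₂ γ) (ρ₂' := 10 * rho₂ γ / 9) (by linarith) (by linarith) u
  have hsubS : richNbrs (sampleDist ψ S) S (10 * rho₁ γ / 11) (10 * rho₂ γ / 9) u ⊆ S :=
    fun v hv => (mem_richNbrs.1 hv).1.1
  rw [hS.setA₁_eq hγ j huS, hS.setA₂_eq hγ j huS]
  generalize richNbrs (sampleDist ψ S) S (rho₁ γ) (rho₂ γ) u = A₁ at hA₁ hsub ⊢
  generalize richNbrs (sampleDist ψ S) S (10 * rho₁ γ / 11) (10 * rho₂ γ / 9) u = A₂
    at hA₂ hsub hsubS ⊢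
  have p1 : γ ^ 138 ≤ γ ^ 74 := pow_le_pow_of_le_one hγ.le hγ1 (by norm_num)
  have p2 : γ ^ 1070 ≤ γ ^ 74 := pow_le_pow_of_le_one hγ.le hγ1 (by norm_num)
  have p3 : γ ^ 932 ≤ γ ^ 794 := pow_le_pow_of_le_one hγ.le hγ1 (by norm_num)
  have hA₁pos : (0 : ℝ) < A₁.card := lt_of_lt_of_le (by positivity) hA₁
  have c12 : (A₁.card : ℝ) ≤ A₂.card := by exact_mod_cast Finset.card_le_card hsub
  have c2S : (A₂.card : ℝ) ≤ S.card := by exact_mod_cast Finset.card_le_card hsubS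
  refine ⟨le_trans (by gcongr) hA₁, hA₂.trans ?_, ?_⟩
  · have := sumsetConst_pos
    gcongr
  · rw [le_div_iff₀ (by linarith)]
    refine le_trans ?_ hA₁
    gcongr

lemma IsGoodSet.prChoice_ge (hS : IsGoodSet ψ γ S) (hψ : IsState ψ) (hγ : 0 < γ) (hγ1 : γ ≤ 1) :
    1 / (4 * C₁ * C₂) * γ ^ 487 ≤ prChoice ψ S γ fun j u =>
      1 / (4 * C₁ * C₂) * γ ^ 138 * (S.card : ℝ) ≤ ((setA₁ ψ S γ j u).card : ℝ) ∧
      ((setA₂ ψ S γ j u + setA₂ ψ S γ j u).card : ℝ) ≤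
        sumsetConst * (γ ^ 932)⁻¹ * (S.card : ℝ) ∧
      1 / (4 * C₁ * C₂) * γ ^ 1070 ≤
        ((setA₁ ψ S γ j u).card : ℝ) / ((setA₂ ψ S γ j u).card : ℝ) := by
  have h1 := C₁_pos
  have h2 := C₂_pos
  have hI : (0 : ℝ) < numIntervals γ := by exact_mod_cast numIntervals_pos hγ
  have p : γ ^ 487 ≤ γ ^ 64 := pow_le_pow_of_le_one hγ.le hγ1 (by norm_num)
  rw [prChoice, le_div_iff₀ hI]
  have := Finset.card_nsmul_le_sum Finset.univ _ _ fun j _ => hS.prSample_ge hψ hγ hγ1 j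
  rw [Finset.card_univ, Fintype.card_fin, nsmul_eq_mul, mul_comm] at this
  refine le_trans ?_ this
  gcongr

end Conclusion

end BSG

theorem mainTheorem9 :
    ∃ (r s T : ℝ → ℝ → ℕ) (K : ℕ) (c C : ℝ), 0 < c ∧ 0 < C ∧
      (∀ γ δ : ℝ, 0 < γ → γ ≤ 1 → 0 < δ → δ < 1 →
        (r γ δ : ℝ) ≤ K * (1 / γ) ^ K * (1 + Real.log (1 / δ)) ^ K ∧
        (s γ δ : ℝ) ≤ K * (1 / γ) ^ K * (1 + Real.log (1 / δ)) ^ K ∧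
        (T γ δ : ℝ) ≤ K * (1 / γ) ^ K * (1 + Real.log (1 / δ)) ^ K) ∧
      ∀ (n : ℕ) (ψ : BSG.Bits n → ℂ) (γ : ℝ) (S : Finset (BSG.Vec n)),
        BSG.IsState ψ → 0 < γ →
        γ ≤ ∑ x, BSG.weylDist ψ x * BSG.weight ψ x →
        BSG.IsGoodSet ψ γ S →
        (∀ (j : Fin (BSG.numIntervals γ)), ∀ u ∈ S,
          BSG.setA₁ ψ S γ j u ⊆ BSG.setA₂ ψ S γ j u ∧
          ∀ δ : ℝ, 0 < δ → δ < 1 → ∀ v ∈ S,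
            1 - δ ≤ BSG.prBSGTest (r γ δ) (s γ δ) (T γ δ) ψ S u v
              (BSG.zeta γ j + BSG.mu γ / 2) (BSG.zeta γ j - BSG.mu γ / 2)
              (BSG.zeta γ j + BSG.mu γ / 2)
              (21 * BSG.rho₁ γ / 22) (19 * BSG.rho₂ γ / 18)
              (fun F => (F = 1 → v ∈ BSG.setA₂ ψ S γ j u) ∧
                (F = 0 → v ∉ BSG.setA₁ ψ S γ j u))) ∧
        c * γ ^ 487 ≤ BSG.prChoice ψ S γ (fun j u =>
          c * γ ^ 138 * (S.card : ℝ) ≤ ((BSG.setA₁ ψ S γ j u).card : ℝ) ∧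
          ((BSG.setA₂ ψ S γ j u + BSG.setA₂ ψ S γ j u).card : ℝ) ≤
            C * (γ ^ 932)⁻¹ * (S.card : ℝ) ∧
          c * γ ^ 1070 ≤
            ((BSG.setA₁ ψ S γ j u).card : ℝ) / ((BSG.setA₂ ψ S γ j u).card : ℝ)) := by
  obtain ⟨Kr, hKr⟩ := BSG.polyBounded_sizeR.exists_le
  obtain ⟨Ks, hKs⟩ := BSG.polyBounded_sizeS.exists_le
  obtain ⟨KT, hKT⟩ := BSG.polyBounded_sizeT.exists_le
  have h1 := BSG.C₁_pos
  have h2 := BSG.C₂_pos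
  refine ⟨BSG.sizeR, BSG.sizeS, BSG.sizeT, Kr + Ks + KT, 1 / (4 * BSG.C₁ * BSG.C₂),
    BSG.sumsetConst, by positivity, BSG.sumsetConst_pos, fun γ δ hγ hγ1 hδ hδ1 =>
    ⟨hKr _ (by omega) γ δ hγ hγ1 hδ hδ1, hKs _ (by omega) γ δ hγ hγ1 hδ hδ1,
      hKT _ (by omega) γ δ hγ hγ1 hδ hδ1⟩, fun n ψ γ S hψ hγ hmean hS => ?_⟩
  have hγ1 := BSG.le_one_of_le_mean hψ hmean
  refine ⟨fun j u hu => ⟨?_, fun δ hδ hδ1 v hv =>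
    hS.prBSGTest_sizes_ge hψ hγ hγ1 j hu hv hδ hδ1⟩, hS.prChoice_ge hψ hγ hγ1⟩
  have hρ₁ := BSG.rho₁_pos hγ
  have hρ₂ := BSG.rho₂_pos hγ
  rw [hS.setA₁_eq hγ j hu, hS.setA₂_eq hγ j hu]
  exact BSG.richNbrs_mono (hS.isPMF_sampleDist hγ).nonneg (by linarith) (by linarith) u
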